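/- Let $\mathbb H=\mathbb R$ or $\mathbb C$. For $A\in\mathbb H^{d\times d}$ let $\mathbf D(A)$ be the diagonal matrix with the same diagonal as $A$. For a random vector $a$ in $\mathbb H^d$ put $\|a\|_{\psi_2}=\sup_{\|v\|=1}\sup_{p\ge 1}p^{-1/2}(\mathbb E|a^*v|^p)^{1/p}$; $a$ is called sub-gaussian if this is finite. Consider the following conditions on i.i.d. sub-gaussian random vectors $a_1,\dots,a_N$ in $\mathbb H^d$, with $A_j:=a_ja_j^*$. (I) With probability one, $A_j-\mathbf D(A_j)$ is not purely imaginary (some entry has nonzero real part), and $\mathbf D(A_j)$ is not a scalar multiple of the identity $I$. (In particular $d\ge 2$.) (II) $\mathbb E(a_j)=0$, $\mathbb E(A_j)=\tau_1 I$, and for all $x\in\mathbb H^d$ $$\mathbb E\big((x^*A_jx)A_j\big)=\tau_2\|x\|^2I+\tau_3\,xx^*+\tau_4\,\mathrm{diag}(|x_1|^2,\dots,|x_d|^2),$$ where $\tau_1,\dots,\tau_4\in\mathbb R$ do not depend on $x$. For $x\in\mathbb H^d$ let $y_j=x^*A_jx=|a_j^*x|^2$, $\rho=\big(\frac1{\tau_1N}\sum_{j=1}^N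 y_j\big)^{1/2}$, $Y=\frac1N\sum_{j=1}^N y_jA_j$ and $$M=Y-\frac{\tau_4}{\tau_3+\tau_4}\,\mathbf D(Y-\tau_2\rho^2I).$$ A generalized spectral initialization is a vector $z_0=\rho v$, where $v$ is a unit eigenvector of the Hermitian matrix $M$ for its largest eigenvalue. Let $\mathrm{dist}(z,x)=\min_{u\in\mathbb H,\,|u|=1}\|z-ux\|$. **Theorem.** For every $\varepsilon>0$, $K\ge 0$ and $\tau_1,\dots,\tau_4\in\mathbb R$ there are constants $c_\varepsilon,C_\varepsilon>0$, depending only on $\varepsilon$, $K$, $\tau_1,\dots,\tau_4$ (and on whether $\mathbb H$ is $\mathbb R$ or $\mathbb C$), such that the following holds for all $d$ and $N$. If $a_1,\dots,a_N$ are i.i.d. sub-gaussian random vectors in $\mathbb H^d$ with $\|a_j\|_{\psi_2}\le K$ that satisfy (I) and (II) with these $\tau_1,\dots,\tau_4$, and if $N\ge C_\varepsilon d\log^2 d$, then for every fixed $x\in\mathbb H^d$, with probability at least $1-1/d^3-2\exp(-c_\varepsilon N)$, every generalized spectral initialization $z_0$ satisfies $$\mathrm{dist}(z_0,x)\le\varepsilon\|x\|.$$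 -/

import Mathlib

open MeasureTheory ProbabilityTheory
open scoped ENNReal NNReal

namespace PhaseRetrieval

noncomputable section

universe u v

variable {𝕜 : Type u} [RCLike 𝕜] {d N : ℕ} {Ω : Type v} [MeasurableSpace Ω]

/-- The sub-gaussian norm `‖X‖_ψ₂ = sup_{p ≥ 1} p^{-1/2} (E |X|^p)^{1/p}` of a scalar random
variable, with value `∞` when `X` is not sub-gaussian. -/
def psi2Norm (X : Ω → 𝕜) (μ : Measure Ω) : ℝ≥0∞ :=
  ⨆ p : Set.Ici (1 : ℝ), eLpNorm X (ENNReal.ofReal p) μ / ENNReal.ofReal (Real.sqrt p)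

/-- The sub-gaussian norm of a random vector: the supremum of `‖a^* v‖_ψ₂` over unit vectors `v`.
The vector is sub-gaussian when this is finite. -/
def vecPsi2Norm (a : Ω → EuclideanSpace 𝕜 (Fin d)) (μ : Measure Ω) : ℝ≥0∞ :=
  ⨆ v : Metric.sphere (0 : EuclideanSpace 𝕜 (Fin d)) 1,
    psi2Norm (fun ω => inner 𝕜 (a ω) (v : EuclideanSpace 𝕜 (Fin d))) μ

/-- The rank one matrix `A = a a^*`. -/
def outer (a : EuclideanSpace 𝕜 (Fin d)) : Matrix (Fin d) (Fin d) 𝕜 :=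
  Matrix.vecMulVec a.ofLp (star a.ofLp)

/-- `D(A)`: the diagonal matrix with the same diagonal as `A`. -/
def diagPart (A : Matrix (Fin d) (Fin d) 𝕜) : Matrix (Fin d) (Fin d) 𝕜 :=
  Matrix.diagonal A.diag

/-- The quadratic measurement `y = x^* (a a^*) x = |a^* x|²`. -/
def measurement (a x : EuclideanSpace 𝕜 (Fin d)) : ℝ :=
  ‖(inner 𝕜 a x : 𝕜)‖ ^ 2

theorem quadForm_outer (a x : EuclideanSpace 𝕜 (Fin d)) :
    star x.ofLp ⬝ᵥ (outer a).mulVec x.ofLp = ((measurement a x : ℝ) : 𝕜) := by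
  have h : (inner 𝕜 a x : 𝕜) = star a.ofLp ⬝ᵥ x.ofLp := by
    rw [EuclideanSpace.inner_eq_star_dotProduct, dotProduct_comm]
  have h2 : star (star a.ofLp ⬝ᵥ x.ofLp) = star x.ofLp ⬝ᵥ a.ofLp := by
    rw [Matrix.star_dotProduct, star_star]
  rw [measurement, h, outer, Matrix.vecMulVec_mulVec, dotProduct_smul, ← h2]
  simpa using RCLike.conj_mul (star a.ofLp ⬝ᵥ x.ofLp)

/-- Entrywise expectation of a random matrix. -/
def matrixExpectation (X : Ω → Matrix (Fin d) (Fin d) 𝕜) (μ : Measure Ω) :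
    Matrix (Fin d) (Fin d) 𝕜 :=
  Matrix.of fun k m => ∫ ω, X ω k m ∂μ

/-- The nondegeneracy requirement in condition (I): with probability one, the off-diagonal part
`A - D(A)` of `A = a a^*` is not purely imaginary (some entry has a nonzero real part) and `D(A)`
is not a scalar multiple of the identity. -/
structure ConditionI (a : Ω → EuclideanSpace 𝕜 (Fin d)) (μ : Measure Ω) : Prop where
  not_imaginary : ∀ᵐ ω ∂μ,
    ¬ ∀ k m, RCLike.re ((outer (a ω) - diagPart (outer (a ω))) k m) = 0
  not_scalar : ∀ᵐ ω ∂μ,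
    ∀ c : 𝕜, diagPart (outer (a ω)) ≠ c • (1 : Matrix (Fin d) (Fin d) 𝕜)

/-- The moment condition (II), with constants `τ₁, τ₂, τ₃, τ₄`. -/
structure ConditionII (a : Ω → EuclideanSpace 𝕜 (Fin d)) (μ : Measure Ω)
    (τ₁ τ₂ τ₃ τ₄ : ℝ) : Prop where
  mean : ∫ ω, a ω ∂μ = 0
  second : matrixExpectation (fun ω => outer (a ω)) μ =
    (τ₁ : 𝕜) • (1 : Matrix (Fin d) (Fin d) 𝕜)
  fourth : ∀ x : EuclideanSpace 𝕜 (Fin d),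
    matrixExpectation (fun ω => ((measurement (a ω) x : ℝ) : 𝕜) • outer (a ω)) μ =
      ((τ₂ * ‖x‖ ^ 2 : ℝ) : 𝕜) • (1 : Matrix (Fin d) (Fin d) 𝕜)
        + (τ₃ : 𝕜) • outer x
        + (τ₄ : 𝕜) • Matrix.diagonal fun k => ((‖x k‖ ^ 2 : ℝ) : 𝕜)

/-- `ρ² = (1 / (τ₁ N)) ∑ⱼ yⱼ`. -/
def rhoSq (τ₁ : ℝ) (a : Fin N → EuclideanSpace 𝕜 (Fin d)) (x : EuclideanSpace 𝕜 (Fin d)) : ℝ :=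
  (1 / (τ₁ * N)) * ∑ j, measurement (a j) x

/-- `Y = (1 / N) ∑ⱼ yⱼ Aⱼ`. -/
def matY (a : Fin N → EuclideanSpace 𝕜 (Fin d)) (x : EuclideanSpace 𝕜 (Fin d)) :
    Matrix (Fin d) (Fin d) 𝕜 :=
  ((1 / N : ℝ) : 𝕜) • ∑ j, ((measurement (a j) x : ℝ) : 𝕜) • outer (a j)

/-- `M = Y - τ₄ / (τ₃ + τ₄) D(Y - τ₂ ρ² I)`. -/
def matM (τ₁ τ₂ τ₃ τ₄ : ℝ) (a : Fin N → EuclideanSpace 𝕜 (Fin d))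
    (x : EuclideanSpace 𝕜 (Fin d)) : Matrix (Fin d) (Fin d) 𝕜 :=
  matY a x - ((τ₄ / (τ₃ + τ₄) : ℝ) : 𝕜) •
    diagPart (matY a x - ((τ₂ * rhoSq τ₁ a x : ℝ) : 𝕜) • (1 : Matrix (Fin d) (Fin d) 𝕜))

/-- `z₀` is a generalized spectral initialization: `z₀ = ρ v` for a unit eigenvector `v` of the
Hermitian matrix `M` belonging to its largest eigenvalue. -/
def IsSpectralInit (τ₁ τ₂ τ₃ τ₄ : ℝ) (a : Fin N → EuclideanSpace 𝕜 (Fin d))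
    (x z₀ : EuclideanSpace 𝕜 (Fin d)) : Prop :=
  ∃ (l : ℝ) (v : EuclideanSpace 𝕜 (Fin d)),
    IsGreatest
      {t : ℝ | Module.End.HasEigenvalue (Matrix.toLin' (matM τ₁ τ₂ τ₃ τ₄ a x)) (t : 𝕜)} l ∧
    (matM τ₁ τ₂ τ₃ τ₄ a x).mulVec v.ofLp = (l : 𝕜) • v.ofLp ∧
    ‖v‖ = 1 ∧
    z₀ = ((Real.sqrt (rhoSq τ₁ a x) : ℝ) : 𝕜) • v

/-- The distance up to a unimodular scalar, `dist(z, x) = min_{|u| = 1} ‖z - u x‖`. -/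
def phaseDist (z x : EuclideanSpace 𝕜 (Fin d)) : ℝ :=
  ⨅ u : Metric.sphere (0 : 𝕜) 1, ‖z - (u : 𝕜) • x‖

end

end PhaseRetrieval

/-! By (II), `Y` has mean `τ₂‖x‖²I + τ₃xx* + τ₄ diag(|x_k|²)`. The diagonal of this mean, less
`τ₂‖x‖²`, is `(τ₃+τ₄)|x_k|²`, so the correction by `τ₄/(τ₃+τ₄)` cancels the `τ₄` term and `M` is
close to `τ₂‖x‖²I + τ₃xx*`. Condition (I) forces `τ₁ ≠ 0`, `τ₃ > 0` and `τ₃+τ₄ ≠ 0`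
(`ConditionI.parameters`), so the limit is well defined and its top eigenspace is the line of `x`
when `x ≠ 0`.

Matrices enter only through quadratic forms. If the form of `M` is uniformly close to its limit on
the sphere, evaluating it at `x/‖x‖` and at the top eigenvector `v` shows that the two are nearly
parallel, while `ρ ≈ ‖x‖` fixes the length (`phaseDist_le_of_isSpectralInit`).

Uniform closeness comes from a net (`abs_re_inner_le_of_abs_le_on_net`) and scalar concentration at
each net point (`exists_concentration_event`). There the summand is `UV` with `U = |a*e|²`, `V =
|a*v|²` for unit `e`, `v`. Both factors have exponential moments but the product need not.
Truncating at `U ≤ T` with `T` of order `log N` restores an exponential moment of order `1/T` and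
gives a tail `exp(-cN/log N)`, which beats the `25^d` net points once `N/log N` is a large multiple
of `d`. The vector `e` is fixed, so the truncation event does not depend on the net point and costs
only `N · 2N⁻⁶`. These two failures account for `1/d³`; the concentration of `ρ` accounts for
`2exp(-cN)`. -/

namespace PhaseRetrieval

/-! ### Exponential moments and Chernoff bounds for scalar variables. -/

section Scalar

variable {Ω : Type*} [MeasurableSpace Ω] {μ : Measure Ω}

/-- `U` has an exponential moment of order `S` bounded by `2`. -/
structure HasExpMoment (S : ℝ) (U : Ω → ℝ) (μ : Measure Ω) : Prop where
  integrable : Integrable (fun ω => Real.exp (S * U ω)) μ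
  integral_le : ∫ ω, Real.exp (S * U ω) ∂μ ≤ 2

theorem HasExpMoment.integrable_of_le {S C : ℝ} {U V f : Ω → ℝ} (hU : HasExpMoment S U μ)
    (hV : HasExpMoment S V μ) (hf : AEStronglyMeasurable f μ)
    (h : ∀ ω, |f ω| ≤ C * (Real.exp (S * U ω) + Real.exp (S * V ω))) : Integrable f μ :=
  ((hU.integrable.add hV.integrable).const_mul C).mono' hf (ae_of_all _ h)

theorem HasExpMoment.integral_le_of_le {S C : ℝ} {U V f : Ω → ℝ} (hU : HasExpMoment S U μ)
    (hV : HasExpMoment S V μ) (hf : AEStronglyMeasurable f μ) (hC : 0 ≤ C)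
    (h : ∀ ω, |f ω| ≤ C * (Real.exp (S * U ω) + Real.exp (S * V ω))) :
    ∫ ω, f ω ∂μ ≤ 4 * C := by
  have h1 : ∫ ω, f ω ∂μ ≤ ∫ ω, C * (Real.exp (S * U ω) + Real.exp (S * V ω)) ∂μ :=
    integral_mono (hU.integrable_of_le hV hf h)
      ((hU.integrable.add hV.integrable).const_mul C) fun ω => (le_abs_self _).trans (h ω)
  rw [integral_const_mul, integral_add hU.integrable hV.integrable] at h1
  nlinarith [hU.integral_le, hV.integral_le]

theorem HasExpMoment.measureReal_gt_le [IsProbabilityMeasure μ] {S : ℝ} (hS : 0 < S)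
    {U : Ω → ℝ} (hU : HasExpMoment S U μ) (T : ℝ) :
    μ.real {ω | T < U ω} ≤ 2 * Real.exp (-(S * T)) := by
  have h1 : μ.real {ω | T < U ω} ≤ μ.real {ω | Real.exp (S * T) ≤ Real.exp (S * U ω)} := by
    refine measureReal_mono fun ω hω => ?_
    simp only [Set.mem_ofPred_eq] at hω ⊢
    gcongr
  have h2 := mul_meas_ge_le_integral_of_nonneg
    (ae_of_all μ fun ω => (Real.exp_pos (S * U ω)).le) hU.integrable (Real.exp (S * T))
  have h3 : Real.exp (S * T) * μ.real {ω | T < U ω} ≤ 2 :=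
    (mul_le_mul_of_nonneg_left h1 (Real.exp_pos _).le).trans (h2.trans hU.integral_le)
  rw [Real.exp_neg, ← div_eq_mul_inv, le_div_iff₀ (Real.exp_pos _)]
  linarith

theorem exp_le_one_add_add_sq_mul_exp (y : ℝ) : Real.exp y ≤ 1 + y + y ^ 2 * Real.exp |y| := by
  have h := Complex.norm_exp_sub_sum_le_norm_mul_exp (y : ℂ) 2
  have h2 : Complex.exp y - ∑ m ∈ Finset.range 2, (y : ℂ) ^ m / (m.factorial : ℂ)
      = ((Real.exp y - (1 + y) : ℝ) : ℂ) := by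
    simp [Finset.sum_range_succ]
  rw [h2, Complex.norm_real, Complex.norm_real, Real.norm_eq_abs, Real.norm_eq_abs, sq_abs] at h
  linarith [le_abs_self (Real.exp y - (1 + y))]

theorem sq_le_exp {η u : ℝ} (hη : 0 < η) (hu : 0 ≤ u) : u ^ 2 ≤ 2 / η ^ 2 * Real.exp (η * u) := by
  have h := Real.pow_div_factorial_le_exp (η * u) (by positivity) 2
  rw [div_mul_eq_mul_div, le_div_iff₀ (by positivity)]
  rw [Nat.factorial_two, div_le_iff₀ (by norm_num), mul_pow] at h
  push_cast at h
  linarith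

theorem le_exp_mul {η u : ℝ} (hη : 0 < η) : u ≤ 1 / η * Real.exp (η * u) := by
  rw [div_mul_eq_mul_div, le_div_iff₀ hη, one_mul]
  linarith [Real.add_one_le_exp (η * u)]

/-- Takes the place of Hölder: an exponent `αU + βV` with `U, V ≥ 0` and `α + β ≤ S` is at most `S
max(U, V)`, so marginal exponential moments control joint quantities. -/
theorem exp_le_exp_add_exp {a b c S : ℝ} (h : c ≤ S * max a b) :
    Real.exp c ≤ Real.exp (S * a) + Real.exp (S * b) := by
  have h1 : Real.exp c ≤ Real.exp (S * max a b) := Real.exp_le_exp.2 h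
  rcases le_total a b with hab | hab
  · rw [max_eq_right hab] at h1
    linarith [Real.exp_pos (S * a)]
  · rw [max_eq_left hab] at h1
    linarith [Real.exp_pos (S * b)]

/-- Expand `exp(lW)` to second order. The linear term is cancelled by centring, and for `|l| ≤ s`
the remainder is at most `l²W²exp(sW)`, whose mean is at most `l²B`. -/
theorem integrable_and_mgf_sub_integral_le [IsProbabilityMeasure μ] {W : Ω → ℝ} {s B l : ℝ}
    (hW : Measurable W) (hW0 : ∀ ω, 0 ≤ W ω) (hWi : Integrable W μ)
    (hB : Integrable (fun ω => W ω ^ 2 * Real.exp (s * W ω)) μ)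
    (hB' : ∫ ω, W ω ^ 2 * Real.exp (s * W ω) ∂μ ≤ B) (hl : |l| ≤ s) :
    Integrable (fun ω => Real.exp (l * (W ω - ∫ ω, W ω ∂μ))) μ ∧
      mgf (fun ω => W ω - ∫ ω, W ω ∂μ) μ l ≤ Real.exp (l ^ 2 * B) := by
  set m := ∫ ω, W ω ∂μ
  have hpt : ∀ ω, Real.exp (l * W ω)
      ≤ 1 + l * W ω + l ^ 2 * (W ω ^ 2 * Real.exp (s * W ω)) := by
    intro ω
    refine (exp_le_one_add_add_sq_mul_exp _).trans ?_
    have : Real.exp |l * W ω| ≤ Real.exp (s * W ω) := by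
      rw [abs_mul, abs_of_nonneg (hW0 ω)]
      exact Real.exp_le_exp.2 (mul_le_mul_of_nonneg_right hl (hW0 ω))
    nlinarith [mul_le_mul_of_nonneg_left this (sq_nonneg (l * W ω))]
  have hdom : Integrable
      (fun ω => 1 + l * W ω + l ^ 2 * (W ω ^ 2 * Real.exp (s * W ω))) μ :=
    ((integrable_const _).add (hWi.const_mul l)).add (hB.const_mul _)
  have hint : Integrable (fun ω => Real.exp (l * W ω)) μ :=
    hdom.mono' (by fun_prop) (ae_of_all _ fun ω => by
      rw [Real.norm_eq_abs, abs_of_pos (Real.exp_pos _)]; exact hpt ω)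
  have heq : (fun ω => Real.exp (l * (W ω - m)))
      = fun ω => Real.exp (-(l * m)) * Real.exp (l * W ω) := by
    funext ω
    rw [← Real.exp_add]
    ring_nf
  refine ⟨heq ▸ hint.const_mul _, ?_⟩
  rw [mgf, heq, integral_const_mul]
  have h1 : ∫ ω, Real.exp (l * W ω) ∂μ ≤ 1 + l * m + l ^ 2 * B := by
    refine (integral_mono hint hdom hpt).trans ?_
    have hlin : Integrable (fun ω => 1 + l * W ω) μ := (integrable_const _).add (hWi.const_mul l)
    rw [integral_add hlin (hB.const_mul _),
      integral_add (integrable_const _) (hWi.const_mul l), integral_const_mul, integral_const_mul]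
    simp only [integral_const, probReal_univ, smul_eq_mul, one_mul]
    nlinarith [sq_nonneg l]
  have h2 : 1 + l * m + l ^ 2 * B ≤ Real.exp (l * m + l ^ 2 * B) := by
    linarith [Real.add_one_le_exp (l * m + l ^ 2 * B)]
  calc Real.exp (-(l * m)) * ∫ ω, Real.exp (l * W ω) ∂μ
      ≤ Real.exp (-(l * m)) * Real.exp (l * m + l ^ 2 * B) :=
        mul_le_mul_of_nonneg_left (h1.trans h2) (Real.exp_pos _).le
    _ = Real.exp (l ^ 2 * B) := by rw [← Real.exp_add]; ring_nf

/-- Chernoff's bound at a prescribed `l`: the condition `2lB ≤ δ` lets the variance term `l²BN` use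
up at most half of the gain `lδN`. -/
theorem measureReal_abs_sum_sub_integral_ge_le [IsProbabilityMeasure μ] {N : ℕ}
    {W : Fin N → Ω → ℝ} {s B l δ : ℝ} (hW : ∀ j, Measurable (W j)) (hW0 : ∀ j ω, 0 ≤ W j ω)
    (hind : iIndepFun W μ) (hWi : ∀ j, Integrable (W j) μ)
    (hB : ∀ j, Integrable (fun ω => W j ω ^ 2 * Real.exp (s * W j ω)) μ)
    (hB' : ∀ j, ∫ ω, W j ω ^ 2 * Real.exp (s * W j ω) ∂μ ≤ B) (hl0 : 0 ≤ l) (hl : l ≤ s)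
    (hlB : 2 * l * B ≤ δ) :
    μ.real {ω | N * δ ≤ |∑ j, (W j ω - ∫ ω, W j ω ∂μ)|}
      ≤ 2 * Real.exp (-(l * δ / 2 * N)) := by
  set X : Fin N → Ω → ℝ := fun j ω => W j ω - ∫ ω, W j ω ∂μ with hX
  have hXm : ∀ j, Measurable (X j) := fun j => (hW j).sub_const _
  have hXind : iIndepFun X μ := hind.comp (fun j y => y - ∫ ω, W j ω ∂μ)
    fun j => measurable_id.sub_const _
  have key : ∀ t : ℝ, |t| = l → Integrable (fun ω => Real.exp (t * (∑ j, X j) ω)) μ ∧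
      mgf (∑ j, X j) μ t ≤ Real.exp (l ^ 2 * B * N) := by
    intro t ht
    have hj := fun j => integrable_and_mgf_sub_integral_le (hW j) (hW0 j) (hWi j) (hB j) (hB' j)
      (ht.trans_le hl)
    refine ⟨hXind.integrable_exp_mul_sum hXm fun j _ => (hj j).1, ?_⟩
    rw [hXind.mgf_sum hXm]
    refine (Finset.prod_le_prod (fun j _ => mgf_nonneg) fun j _ => (hj j).2).trans ?_
    rw [Finset.prod_const, Finset.card_univ, Fintype.card_fin, ← Real.exp_nat_mul, ← ht, sq_abs]
    exact (congrArg Real.exp (by ring)).le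
  have hexp : Real.exp (-l * (N * δ)) * Real.exp (l ^ 2 * B * N)
      ≤ Real.exp (-(l * δ / 2 * N)) := by
    rw [← Real.exp_add]
    refine Real.exp_le_exp.2 ?_
    have := mul_le_mul_of_nonneg_left hlB (mul_nonneg hl0 (Nat.cast_nonneg' (α := ℝ) N))
    nlinarith
  obtain ⟨i1, m1⟩ := key l (abs_of_nonneg hl0)
  obtain ⟨i2, m2⟩ := key (-l) (by rw [abs_neg, abs_of_nonneg hl0])
  have u1 := measure_ge_le_exp_mul_mgf (N * δ) hl0 i1
  have u2 := measure_le_le_exp_mul_mgf (-(N * δ)) (neg_nonpos.2 hl0) i2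
  have hsub : {ω | N * δ ≤ |∑ j, (W j ω - ∫ ω, W j ω ∂μ)|}
      ⊆ {ω | N * δ ≤ (∑ j, X j) ω} ∪ {ω | (∑ j, X j) ω ≤ -(N * δ)} := by
    intro ω hω
    simp only [Set.mem_ofPred_eq, Set.mem_union, Finset.sum_apply, hX] at hω ⊢
    rcases le_abs.1 hω with h | h
    · exact Or.inl h
    · exact Or.inr (by linarith)
  calc _ ≤ _ := measureReal_mono hsub
    _ ≤ _ := measureReal_union_le _ _
    _ ≤ Real.exp (-l * (N * δ)) * Real.exp (l ^ 2 * B * N)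
        + Real.exp (-l * (N * δ)) * Real.exp (l ^ 2 * B * N) := by
      refine add_le_add (u1.trans ?_) (u2.trans ?_)
      · exact mul_le_mul_of_nonneg_left m1 (Real.exp_pos _).le
      · have : -(-l) * -(N * δ) = -l * (N * δ) := by ring
        rw [this]
        exact mul_le_mul_of_nonneg_left m2 (Real.exp_pos _).le
    _ ≤ _ := by linarith

end Scalar

/-! ### From the sub-gaussian norm to exponential moments; truncated products. -/

section Moments

variable {Ω : Type*} [MeasurableSpace Ω] {μ : Measure Ω}

theorem lintegral_enorm_pow_le_of_psi2Norm_le {𝕜 : Type*} [RCLike 𝕜] {X : Ω → 𝕜} {K : ℝ≥0}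
    (h : psi2Norm X μ ≤ K) {k : ℕ} (hk : 1 ≤ k) :
    ∫⁻ ω, ‖X ω‖ₑ ^ (2 * k) ∂μ ≤ ENNReal.ofReal ((2 * k * K ^ 2 : ℝ) ^ k) := by
  have hk' : (1 : ℝ) ≤ k := by exact_mod_cast hk
  have hp : (1 : ℝ) ≤ 2 * k := by linarith
  have h1 := (le_iSup (fun p : Set.Ici (1 : ℝ) =>
    eLpNorm X (ENNReal.ofReal p) μ / ENNReal.ofReal (Real.sqrt p)) ⟨2 * k, hp⟩).trans h
  have hs : 0 < Real.sqrt (2 * k) := Real.sqrt_pos.2 (by linarith)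
  have h2 : eLpNorm X (ENNReal.ofReal (2 * k)) μ ≤ K * ENNReal.ofReal (Real.sqrt (2 * k)) := by
    rwa [ENNReal.div_le_iff (by simpa using hs) ENNReal.ofReal_ne_top] at h1
  have h3 : ENNReal.ofReal (2 * k) = (((2 * k : ℕ) : ℝ≥0) : ℝ≥0∞) := by
    rw [← ENNReal.ofReal_coe_nnreal]
    push_cast
    rfl
  have h4 := eLpNorm_nnreal_pow_eq_lintegral (f := X) (μ := μ) (p := ((2 * k : ℕ) : ℝ≥0))
    (by simp; omega)
  rw [← h3] at h4
  simp only [NNReal.coe_natCast, ENNReal.rpow_natCast] at h4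
  rw [← h4]
  refine (pow_le_pow_left' h2 _).trans (le_of_eq ?_)
  rw [← ENNReal.ofReal_coe_nnreal, ← ENNReal.ofReal_mul (by positivity),
    ← ENNReal.ofReal_pow (by positivity), pow_mul, mul_pow, Real.sq_sqrt (by positivity)]
  ring_nf

/-- Integrate the exponential series term by term. With `E|X|^(2k) ≤ (2kK²)^k` and `k^k/k! ≤ e^k ≤
3^k`, the `k`-th term is at most `(6SK²)^k ≤ 2⁻ᵏ`, and the terms sum to `2`. -/
theorem hasExpMoment_of_psi2Norm_le [IsProbabilityMeasure μ] {𝕜 : Type*} [RCLike 𝕜] {X : Ω → 𝕜}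
    (hX : Measurable X) {K : ℝ≥0} (h : psi2Norm X μ ≤ K) :
    HasExpMoment (1 / (12 * ((K : ℝ) + 1) ^ 2)) (fun ω => ‖X ω‖ ^ 2) μ := by
  set S : ℝ := 1 / (12 * ((K : ℝ) + 1) ^ 2) with hS
  have hS0 : 0 < S := by positivity
  have hSK : S * (2 * (K : ℝ) ^ 2) * 3 ≤ 1 / 2 := by
    rw [hS, one_div_mul_eq_div, div_mul_eq_mul_div, div_le_iff₀ (by positivity)]
    nlinarith [K.coe_nonneg, sq_nonneg (K : ℝ)]
  have hterm : ∀ k : ℕ, ∫⁻ ω, ENNReal.ofReal ((S * ‖X ω‖ ^ 2) ^ k / k.factorial) ∂μ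
      ≤ ENNReal.ofReal ((1 / 2) ^ k) := by
    intro k
    rcases Nat.eq_zero_or_pos k with rfl | hk
    · simp
    have e : ∀ ω, ENNReal.ofReal ((S * ‖X ω‖ ^ 2) ^ k / k.factorial)
        = ENNReal.ofReal (S ^ k / k.factorial) * ‖X ω‖ₑ ^ (2 * k) := by
      intro ω
      rw [← ofReal_norm, ← ENNReal.ofReal_pow (norm_nonneg _),
        ← ENNReal.ofReal_mul (by positivity), mul_pow, ← pow_mul, div_mul_eq_mul_div]
    simp_rw [e]
    rw [lintegral_const_mul _ (by fun_prop)]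
    refine (mul_le_mul_right (lintegral_enorm_pow_le_of_psi2Norm_le h hk) _).trans ?_
    rw [← ENNReal.ofReal_mul (by positivity)]
    refine ENNReal.ofReal_le_ofReal ?_
    have hfac : (k : ℝ) ^ k / k.factorial ≤ 3 ^ k := by
      refine (Real.pow_div_factorial_le_exp _ (Nat.cast_nonneg k) k).trans ?_
      rw [← mul_one (k : ℝ), Real.exp_nat_mul]
      exact pow_le_pow_left₀ (Real.exp_pos _).le Real.exp_one_lt_three.le k
    calc S ^ k / k.factorial * (2 * k * K ^ 2 : ℝ) ^ k
        = (S * (2 * (K : ℝ) ^ 2)) ^ k * ((k : ℝ) ^ k / k.factorial) := by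
          rw [div_mul_eq_mul_div, mul_div_assoc', ← mul_pow, ← mul_pow]
          ring_nf
      _ ≤ (S * (2 * (K : ℝ) ^ 2)) ^ k * 3 ^ k := mul_le_mul_of_nonneg_left hfac (by positivity)
      _ ≤ (1 / 2) ^ k := by
          rw [← mul_pow]
          exact pow_le_pow_left₀ (by positivity) hSK k
  have hlint : ∫⁻ ω, ENNReal.ofReal (Real.exp (S * ‖X ω‖ ^ 2)) ∂μ ≤ ENNReal.ofReal 2 := by
    have e : ∀ ω, ENNReal.ofReal (Real.exp (S * ‖X ω‖ ^ 2))
        = ∑' k : ℕ, ENNReal.ofReal ((S * ‖X ω‖ ^ 2) ^ k / k.factorial) := by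
      intro ω
      rw [← ENNReal.ofReal_tsum_of_nonneg (fun k => by positivity)
        (Real.summable_pow_div_factorial _), Real.exp_eq_exp_ℝ, NormedSpace.exp_eq_tsum_div]
    simp_rw [e]
    rw [lintegral_tsum fun k => by fun_prop]
    refine (ENNReal.tsum_le_tsum hterm).trans (le_of_eq ?_)
    rw [← ENNReal.ofReal_tsum_of_nonneg (fun k => by positivity) summable_geometric_two,
      tsum_geometric_two]
  have hm : AEStronglyMeasurable (fun ω => Real.exp (S * ‖X ω‖ ^ 2)) μ := by fun_prop
  refine ⟨⟨hm, ?_⟩, ?_⟩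
  · rw [hasFiniteIntegral_iff_ofReal (ae_of_all _ fun ω => (Real.exp_pos _).le)]
    exact hlint.trans_lt ENNReal.ofReal_lt_top
  · rw [integral_eq_lintegral_of_nonneg_ae (ae_of_all _ fun ω => (Real.exp_pos _).le) hm]
    exact ENNReal.toReal_le_of_le_ofReal (by norm_num) hlint

variable {S : ℝ} {U V : Ω → ℝ}

theorem HasExpMoment.integrable_self (hS : 0 < S) (hU : HasExpMoment S U μ)
    (hUm : Measurable U) (hU0 : ∀ ω, 0 ≤ U ω) : Integrable U μ := by
  refine hU.integrable_of_le (C := 1 / S) hU hUm.aestronglyMeasurable fun ω => ?_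
  rw [abs_of_nonneg (hU0 ω)]
  refine (le_exp_mul hS).trans ?_
  gcongr
  linarith [Real.exp_pos (S * U ω)]

theorem HasExpMoment.integral_sq_mul_exp_le (hS : 0 < S) (hU : HasExpMoment S U μ)
    (hUm : Measurable U) (hU0 : ∀ ω, 0 ≤ U ω) :
    Integrable (fun ω => U ω ^ 2 * Real.exp (S / 2 * U ω)) μ ∧
      ∫ ω, U ω ^ 2 * Real.exp (S / 2 * U ω) ∂μ ≤ 32 / S ^ 2 := by
  have hpt : ∀ ω, |U ω ^ 2 * Real.exp (S / 2 * U ω)|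
      ≤ 8 / S ^ 2 * (Real.exp (S * U ω) + Real.exp (S * U ω)) := by
    intro ω
    rw [abs_of_nonneg (by positivity)]
    have h1 := sq_le_exp (half_pos hS) (hU0 ω)
    calc U ω ^ 2 * Real.exp (S / 2 * U ω)
        ≤ 2 / (S / 2) ^ 2 * Real.exp (S / 2 * U ω) * Real.exp (S / 2 * U ω) := by gcongr
      _ = 8 / S ^ 2 * Real.exp (S * U ω) := by
          rw [mul_assoc, ← Real.exp_add]
          congr 1
          · field_simp; norm_num
          · ring_nf
      _ ≤ _ := by
          gcongr
          linarith [Real.exp_pos (S * U ω)]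
  refine ⟨hU.integrable_of_le hU (by fun_prop) hpt,
    (hU.integral_le_of_le hU (by fun_prop) (by positivity) hpt).trans (le_of_eq (by ring))⟩

theorem HasExpMoment.integrable_mul (hS : 0 < S) (hU : HasExpMoment S U μ)
    (hV : HasExpMoment S V μ) (hUm : Measurable U) (hVm : Measurable V) (hU0 : ∀ ω, 0 ≤ U ω)
    (hV0 : ∀ ω, 0 ≤ V ω) : Integrable (fun ω => U ω * V ω) μ := by
  refine hU.integrable_of_le (C := 2 / S ^ 2) hV (by fun_prop) fun ω => ?_
  rw [abs_of_nonneg (mul_nonneg (hU0 ω) (hV0 ω))]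
  have h1 := sq_le_exp hS (hU0 ω)
  have h2 := sq_le_exp hS (hV0 ω)
  nlinarith [sq_nonneg (U ω - V ω), sq_nonneg (U ω + V ω)]

/-- The product `U V` truncated to the event `U ≤ T`. -/
noncomputable def truncMul (T u v : ℝ) : ℝ := if u ≤ T then u * v else 0

theorem truncMul_nonneg {T u v : ℝ} (hu : 0 ≤ u) (hv : 0 ≤ v) : 0 ≤ truncMul T u v := by
  unfold truncMul
  split_ifs <;> positivity

theorem measurable_truncMul (T : ℝ) : Measurable fun p : ℝ × ℝ => truncMul T p.1 p.2 :=
  Measurable.ite (measurableSet_le measurable_fst measurable_const)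
    (measurable_fst.mul measurable_snd) measurable_const

/-- On `U ≤ T` the exponent `(S/2T)UV` is at most `(S/2)V`, so the variance proxy does not depend on
`T`; the truncation level affects only the admissible range of the Chernoff parameter. -/
theorem HasExpMoment.integral_truncMul_sq_mul_exp_le (hS : 0 < S) (hU : HasExpMoment S U μ)
    (hV : HasExpMoment S V μ) (hUm : Measurable U) (hVm : Measurable V) (hU0 : ∀ ω, 0 ≤ U ω)
    (hV0 : ∀ ω, 0 ≤ V ω) {T : ℝ} (hT : 0 < T) :
    Integrable (fun ω => truncMul T (U ω) (V ω) ^ 2 *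
        Real.exp (S / (2 * T) * truncMul T (U ω) (V ω))) μ ∧
      ∫ ω, truncMul T (U ω) (V ω) ^ 2 * Real.exp (S / (2 * T) * truncMul T (U ω) (V ω)) ∂μ
        ≤ 4096 / S ^ 4 := by
  have hWm : Measurable fun ω => truncMul T (U ω) (V ω) :=
    (measurable_truncMul T).comp (hUm.prodMk hVm)
  have hpt : ∀ ω, |truncMul T (U ω) (V ω) ^ 2 *
      Real.exp (S / (2 * T) * truncMul T (U ω) (V ω))|
      ≤ 1024 / S ^ 4 * (Real.exp (S * U ω) + Real.exp (S * V ω)) := by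
    intro ω
    rw [abs_of_nonneg (by positivity), truncMul]
    split_ifs with hUT
    · have hu := sq_le_exp (show 0 < S / 4 by linarith) (hU0 ω)
      have hv := sq_le_exp (show 0 < S / 4 by linarith) (hV0 ω)
      have he : Real.exp (S / (2 * T) * (U ω * V ω)) ≤ Real.exp (S / 2 * V ω) := by
        refine Real.exp_le_exp.2 ?_
        have : S / (2 * T) * (U ω * V ω) = S / 2 * V ω * (U ω / T) := by field_simp
        rw [this]
        exact mul_le_of_le_one_right (mul_nonneg (by linarith) (hV0 ω)) ((div_le_one hT).2 hUT)
      calc (U ω * V ω) ^ 2 * Real.exp (S / (2 * T) * (U ω * V ω))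
          ≤ (2 / (S / 4) ^ 2 * Real.exp (S / 4 * U ω)) *
            (2 / (S / 4) ^ 2 * Real.exp (S / 4 * V ω)) * Real.exp (S / 2 * V ω) := by
            rw [mul_pow]
            gcongr
        _ = 1024 / S ^ 4 * Real.exp (S / 4 * U ω + S / 4 * V ω + S / 2 * V ω) := by
            rw [Real.exp_add, Real.exp_add]
            field_simp
            norm_num
        _ ≤ _ := by
            gcongr
            refine exp_le_exp_add_exp ?_
            have := mul_le_mul_of_nonneg_left (le_max_left (U ω) (V ω)) hS.le
            have := mul_le_mul_of_nonneg_left (le_max_right (U ω) (V ω)) hS.le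
            linarith
    · simp only [ne_eq, OfNat.ofNat_ne_zero, not_false_eq_true, zero_pow, zero_mul]
      positivity
  refine ⟨hU.integrable_of_le hV (by fun_prop) hpt,
    (hU.integral_le_of_le hV (by fun_prop) (by positivity) hpt).trans (le_of_eq (by ring))⟩

/-- The truncation bias lives on `U > T`, where the factor `exp(S(U - T)/4) ≥ 1` may be inserted for
free. -/
theorem HasExpMoment.abs_integral_truncMul_sub_le (hS : 0 < S) (hU : HasExpMoment S U μ)
    (hV : HasExpMoment S V μ) (hUm : Measurable U) (hVm : Measurable V) (hU0 : ∀ ω, 0 ≤ U ω)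
    (hV0 : ∀ ω, 0 ≤ V ω) (T : ℝ) :
    Integrable (fun ω => truncMul T (U ω) (V ω)) μ ∧
    |∫ ω, truncMul T (U ω) (V ω) ∂μ - ∫ ω, U ω * V ω ∂μ|
      ≤ 64 / S ^ 2 * Real.exp (-(S / 4 * T)) := by
  have hWm : Measurable fun ω => truncMul T (U ω) (V ω) :=
    (measurable_truncMul T).comp (hUm.prodMk hVm)
  have hUV := hU.integrable_mul hS hV hUm hVm hU0 hV0
  have hle : ∀ ω, truncMul T (U ω) (V ω) ≤ U ω * V ω := by
    intro ω
    unfold truncMul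
    split_ifs
    · exact le_rfl
    · exact mul_nonneg (hU0 ω) (hV0 ω)
  have hWi : Integrable (fun ω => truncMul T (U ω) (V ω)) μ :=
    hUV.mono' hWm.aestronglyMeasurable (ae_of_all _ fun ω => by
      rw [Real.norm_eq_abs, abs_of_nonneg (truncMul_nonneg (hU0 ω) (hV0 ω))]
      exact hle ω)
  refine ⟨hWi, ?_⟩
  rw [abs_sub_comm, ← integral_sub hUV hWi,
    abs_of_nonneg (integral_nonneg fun ω => sub_nonneg.2 (hle ω))]
  refine (hU.integral_le_of_le (f := fun ω => U ω * V ω - truncMul T (U ω) (V ω))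
    (C := 16 / S ^ 2 * Real.exp (-(S / 4 * T))) hV (hUV.sub hWi).aestronglyMeasurable (by positivity) fun ω => ?_).trans (le_of_eq (by ring))
  rw [abs_of_nonneg (sub_nonneg.2 (hle ω)), truncMul]
  split_ifs with hUT
  · rw [sub_self]
    positivity
  · have h4 : 0 < S / 4 := by linarith
    calc U ω * V ω - 0
        ≤ (1 / (S / 4) * Real.exp (S / 4 * U ω)) * (1 / (S / 4) * Real.exp (S / 4 * V ω)) := by
          rw [sub_zero]
          exact mul_le_mul (le_exp_mul h4) (le_exp_mul h4) (hV0 ω) (by positivity)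
      _ = 16 / S ^ 2 * Real.exp (S / 4 * U ω + S / 4 * V ω) := by
          rw [Real.exp_add]
          field_simp
          norm_num
      _ ≤ 16 / S ^ 2 * (Real.exp (-(S / 4 * T)) *
          Real.exp (S / 4 * U ω + S / 4 * V ω + S / 4 * U ω)) := by
          gcongr
          rw [← Real.exp_add]
          refine Real.exp_le_exp.2 ?_
          have := mul_le_mul_of_nonneg_left (not_le.1 hUT).le h4.le
          linarith
      _ ≤ _ := by
          rw [← mul_assoc]
          gcongr
          refine exp_le_exp_add_exp ?_
          have := mul_le_mul_of_nonneg_left (le_max_left (U ω) (V ω)) hS.le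
          have := mul_le_mul_of_nonneg_left (le_max_right (U ω) (V ω)) hS.le
          have := mul_nonneg hS.le (hV0 ω)
          linarith

end Moments

/-! ### A net of the unit sphere. -/

section Net

/-- The unit sphere has a `1/2`-net of size exponential in the dimension. -/
theorem exists_half_net_sphere (E : Type*) [NormedAddCommGroup E] [NormedSpace ℝ E]
    [FiniteDimensional ℝ E] :
    ∃ s : Finset E, s.card ≤ 5 ^ Module.finrank ℝ E ∧ (∀ c ∈ s, ‖c‖ = 1) ∧
      ∀ v : E, ‖v‖ = 1 → ∃ c ∈ s, ‖v - c‖ ≤ 1 / 2 := by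
  classical
  let P : ℕ → Prop := fun n => ∃ s : Finset E, s.card = n ∧ (∀ c ∈ s, ‖c‖ = 1) ∧
    ∀ c ∈ s, ∀ d ∈ s, c ≠ d → 1 / 2 ≤ ‖c - d‖
  have hbound : ∀ n, P n → n ≤ 5 ^ Module.finrank ℝ E := by
    rintro n ⟨s, rfl, h1, h2⟩
    -- Doubling turns the separation `1/2` on the unit sphere into separation `1` in the ball of
    -- radius `2`, the normalization of the packing bound.
    have hinj : Function.Injective fun x : E => (2 : ℝ) • x :=
      smul_right_injective E two_ne_zero
    rw [← Finset.card_image_of_injective s hinj]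
    refine Besicovitch.card_le_of_separated _ ?_ ?_
    · intro c hc
      obtain ⟨c', hc', rfl⟩ := Finset.mem_image.1 hc
      rw [norm_smul, h1 c' hc']
      norm_num
    · intro c hc d hd hcd
      obtain ⟨c', hc', rfl⟩ := Finset.mem_image.1 hc
      obtain ⟨d', hd', rfl⟩ := Finset.mem_image.1 hd
      have := h2 c' hc' d' hd' fun h => hcd (by rw [h])
      rw [← smul_sub, norm_smul, Real.norm_ofNat]
      linarith
  have h0 : P 0 := ⟨∅, by simp⟩
  -- A separated set of largest cardinality is a net: a point far from all of `s` could be added to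
  -- it.
  obtain ⟨s, hs, h1, h2⟩ := Nat.findGreatest_spec (Nat.zero_le (5 ^ Module.finrank ℝ E)) h0
  refine ⟨s, hs ▸ Nat.findGreatest_le _, h1, fun v hv => ?_⟩
  by_contra! hcon
  have hvs : v ∉ s := fun h => by
    have := hcon v h
    rw [sub_self, norm_zero] at this
    linarith
  have hP : P (s.card + 1) := by
    refine ⟨insert v s, Finset.card_insert_of_notMem hvs, ?_, ?_⟩
    · intro c hc
      rcases Finset.mem_insert.1 hc with rfl | hc
      exacts [hv, h1 c hc]
    · intro c hc d hd hcd
      rcases Finset.mem_insert.1 hc with hcv | hc' <;>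
        rcases Finset.mem_insert.1 hd with hdv | hd'
      · exact absurd (hcv.trans hdv.symm) hcd
      · rw [hcv]
        exact (hcon d hd').le
      · rw [hdv, norm_sub_rev]
        exact (hcon c hc').le
      · exact h2 c hc' d hd' hcd
  have := Nat.le_findGreatest (hbound _ hP) hP
  omega

end Net

/-! ### Passing from the net to the sphere. -/

section Quadratic

variable {𝕜 E : Type*} [RCLike 𝕜] [NormedAddCommGroup E] [InnerProductSpace 𝕜 E]
  [FiniteDimensional 𝕜 E]

/-- A quadratic form that is small on a `1/2`-net of the unit sphere is small on the sphere. -/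
theorem abs_re_inner_le_of_abs_le_on_net (A : E →ₗ[𝕜] E)
    {s : Finset E} (hs1 : ∀ c ∈ s, ‖c‖ = 1) (hs : ∀ v : E, ‖v‖ = 1 → ∃ c ∈ s, ‖v - c‖ ≤ 1 / 2)
    {η : ℝ} (hη : ∀ c ∈ s, |RCLike.re (inner 𝕜 c (A c))| ≤ η) {v : E} (hv : ‖v‖ = 1) :
    |RCLike.re (inner 𝕜 v (A v))| ≤ 32 * η := by
  have := FiniteDimensional.proper_rclike 𝕜 E
  set q : E → ℝ := fun v => RCLike.re (inner 𝕜 v (A v)) with hqdef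
  have hA : Continuous A := A.continuous_of_finiteDimensional
  have hq : Continuous q := by fun_prop
  obtain ⟨v₀, hv₀, hmax⟩ := (isCompact_sphere (0 : E) 1).exists_isMaxOn ⟨v, by simpa using hv⟩
    (hq.abs.continuousOn)
  have hv₀1 : ‖v₀‖ = 1 := by simpa using hv₀
  have hsmul : ∀ (t : ℝ) v, q ((t : 𝕜) • v) = t ^ 2 * q v := by
    intro t v
    simp only [hqdef, map_smul, inner_smul_left, inner_smul_right, RCLike.conj_ofReal,
      RCLike.re_ofReal_mul]
    ring
  have hcomb : ∀ (a b : ℝ) v w, q ((a : 𝕜) • v - (b : 𝕜) • w) = a ^ 2 * q v + b ^ 2 * q w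
      - a * b * (RCLike.re (inner 𝕜 v (A w)) + RCLike.re (inner 𝕜 w (A v))) := by
    intro a b v w
    simp only [hqdef, map_smul, map_sub, inner_sub_left, inner_sub_right, inner_smul_left,
      inner_smul_right, RCLike.conj_ofReal, RCLike.re_ofReal_mul]
    ring
  have hle : ∀ w : E, |q w| ≤ |q v₀| * ‖w‖ ^ 2 := by
    intro w
    rcases eq_or_ne w 0 with rfl | hw
    · simp [hqdef]
    · have hw' : ‖w‖ ≠ 0 := norm_ne_zero_iff.2 hw
      have h1 : |q (((‖w‖⁻¹ : ℝ) : 𝕜) • w)| ≤ |q v₀| := hmax (by simp [norm_smul, hw'])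
      have h2 : q w = ‖w‖ ^ 2 * q (((‖w‖⁻¹ : ℝ) : 𝕜) • w) := by
        rw [hsmul]
        field_simp
      rw [h2, abs_mul, abs_of_nonneg (sq_nonneg ‖w‖), mul_comm]
      gcongr
  suffices |q v₀| ≤ 32 * η from (hmax (by simpa using hv)).trans this
  obtain ⟨c, hc, hvc⟩ := hs v₀ hv₀1
  have hc1 := hs1 c hc
  have hp2 : ‖v₀ - c‖ ^ 2 ≤ 1 / 4 := by nlinarith [norm_nonneg (v₀ - c)]
  have hin : 2 * RCLike.re (inner 𝕜 v₀ c) = 2 - ‖v₀ - c‖ ^ 2 := by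
    rw [norm_sub_sq (𝕜 := 𝕜), hv₀1, hc1]
    ring
  have hn : ∀ a b : ℝ, ‖(a : 𝕜) • v₀ - (b : 𝕜) • c‖ ^ 2
      = a ^ 2 + b ^ 2 - 2 * (a * b * RCLike.re (inner 𝕜 v₀ c)) := by
    intro a b
    rw [norm_sub_sq (𝕜 := 𝕜), norm_smul, norm_smul, hv₀1, hc1, inner_smul_left, inner_smul_right,
      RCLike.conj_ofReal, RCLike.re_ofReal_mul, RCLike.re_ofReal_mul, RCLike.norm_ofReal,
      RCLike.norm_ofReal, mul_one, mul_one, sq_abs, sq_abs]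
    ring
  -- The coefficients `5/2` and `3/2` give both combinations the same cross terms, so these cancel
  -- in the difference and leave `4(q v₀ - q c)`. No symmetry of `A` is needed. As `‖v₀ - c‖ ≤ 1/2`,
  -- each combination has squared norm at most `31/16`. Hence `|q v₀| ≤ η + (31/32)|q v₀|`, which is
  -- the source of the factor `32`.
  have b1 := hle (((5 / 2 : ℝ) : 𝕜) • v₀ - ((3 / 2 : ℝ) : 𝕜) • c)
  have b2 := hle (((3 / 2 : ℝ) : 𝕜) • v₀ - ((5 / 2 : ℝ) : 𝕜) • c)
  rw [hn] at b1 b2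
  rw [hcomb] at b1 b2
  have hη' := hη c hc
  change |q c| ≤ η at hη'
  have hab : |4 * (q v₀ - q c)| ≤ |q v₀| * (31 / 8) := by
    have e : 4 * (q v₀ - q c) = ((5 / 2) ^ 2 * q v₀ + (3 / 2) ^ 2 * q c
      - 5 / 2 * (3 / 2) * (RCLike.re (inner 𝕜 v₀ (A c)) + RCLike.re (inner 𝕜 c (A v₀))))
      - ((3 / 2) ^ 2 * q v₀ + (5 / 2) ^ 2 * q c
      - 3 / 2 * (5 / 2) * (RCLike.re (inner 𝕜 v₀ (A c)) + RCLike.re (inner 𝕜 c (A v₀)))) := by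
      ring
    rw [e]
    refine (abs_sub _ _).trans ((add_le_add b1 b2).trans ?_)
    rw [← mul_add]
    refine mul_le_mul_of_nonneg_left ?_ (abs_nonneg _)
    linarith
  rw [abs_mul, abs_of_pos (by norm_num : (0 : ℝ) < 4)] at hab
  have := abs_sub_abs_le_abs_sub (q v₀) (q c)
  linarith

end Quadratic

/-! ### Calculus of quadratic forms and measurements. -/

section QuadForm

variable {𝕜 : Type*} [RCLike 𝕜] {d : ℕ}

/-- The real part of the quadratic form `v^* A v`. -/
noncomputable def quadRe (A : Matrix (Fin d) (Fin d) 𝕜) (v : EuclideanSpace 𝕜 (Fin d)) : ℝ :=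
  RCLike.re (star v.ofLp ⬝ᵥ A.mulVec v.ofLp)

theorem quadRe_eq_re_inner (A : Matrix (Fin d) (Fin d) 𝕜) (v : EuclideanSpace 𝕜 (Fin d)) :
    quadRe A v = RCLike.re (inner 𝕜 v (Matrix.toEuclideanLin A v)) := by
  rw [quadRe, EuclideanSpace.inner_eq_star_dotProduct, dotProduct_comm]
  rfl

theorem quadRe_eq_sum (A : Matrix (Fin d) (Fin d) 𝕜) (v : EuclideanSpace 𝕜 (Fin d)) :
    quadRe A v = ∑ k, ∑ m, RCLike.re (star (v k) * v m * A k m) := by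
  simp only [quadRe, dotProduct, Matrix.mulVec, Finset.mul_sum, map_sum, Pi.star_apply]
  refine Finset.sum_congr rfl fun k _ => Finset.sum_congr rfl fun m _ => ?_
  ring_nf

theorem quadRe_add (A B : Matrix (Fin d) (Fin d) 𝕜) (v : EuclideanSpace 𝕜 (Fin d)) :
    quadRe (A + B) v = quadRe A v + quadRe B v := by
  simp [quadRe, Matrix.add_mulVec, dotProduct_add]

theorem quadRe_sub (A B : Matrix (Fin d) (Fin d) 𝕜) (v : EuclideanSpace 𝕜 (Fin d)) :
    quadRe (A - B) v = quadRe A v - quadRe B v := by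
  simp [quadRe, Matrix.sub_mulVec, dotProduct_sub]

theorem quadRe_sum {ι : Type*} (s : Finset ι) (A : ι → Matrix (Fin d) (Fin d) 𝕜)
    (v : EuclideanSpace 𝕜 (Fin d)) : quadRe (∑ i ∈ s, A i) v = ∑ i ∈ s, quadRe (A i) v := by
  simp [quadRe, Matrix.sum_mulVec, dotProduct_sum]

theorem quadRe_smul (t : ℝ) (A : Matrix (Fin d) (Fin d) 𝕜) (v : EuclideanSpace 𝕜 (Fin d)) :
    quadRe ((t : 𝕜) • A) v = t * quadRe A v := by
  rw [quadRe, Matrix.smul_mulVec, dotProduct_smul, smul_eq_mul, RCLike.re_ofReal_mul, quadRe]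

theorem quadRe_outer (a v : EuclideanSpace 𝕜 (Fin d)) : quadRe (outer a) v = measurement a v := by
  rw [quadRe, quadForm_outer, RCLike.ofReal_re]

theorem quadRe_diagonal (D : Fin d → 𝕜) (v : EuclideanSpace 𝕜 (Fin d)) :
    quadRe (Matrix.diagonal D) v = ∑ k, RCLike.re (D k) * ‖v k‖ ^ 2 := by
  simp only [quadRe, dotProduct, Matrix.mulVec_diagonal, map_sum, Pi.star_apply]
  refine Finset.sum_congr rfl fun k _ => ?_
  have : star (v k) * (D k * v k) = ((‖v k‖ ^ 2 : ℝ) : 𝕜) * D k := by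
    rw [mul_left_comm, mul_comm, RCLike.star_def, RCLike.conj_mul]
    push_cast
    rfl
  rw [this, RCLike.re_ofReal_mul, mul_comm]

theorem quadRe_one (v : EuclideanSpace 𝕜 (Fin d)) :
    quadRe (1 : Matrix (Fin d) (Fin d) 𝕜) v = ‖v‖ ^ 2 := by
  rw [← Matrix.diagonal_one, quadRe_diagonal, EuclideanSpace.norm_sq_eq]
  simp

/-- The quadratic form of the matrix on the right hand side of the fourth moment condition. -/
noncomputable def fourthForm (τ₂ τ₃ τ₄ : ℝ) (x v : EuclideanSpace 𝕜 (Fin d)) : ℝ :=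
  τ₂ * ‖x‖ ^ 2 * ‖v‖ ^ 2 + τ₃ * measurement x v + τ₄ * ∑ k, ‖x k‖ ^ 2 * ‖v k‖ ^ 2

theorem quadRe_fourth_eq (τ₂ τ₃ τ₄ : ℝ) (x v : EuclideanSpace 𝕜 (Fin d)) :
    quadRe (((τ₂ * ‖x‖ ^ 2 : ℝ) : 𝕜) • (1 : Matrix (Fin d) (Fin d) 𝕜)
        + (τ₃ : 𝕜) • outer x
        + (τ₄ : 𝕜) • Matrix.diagonal fun k => ((‖x k‖ ^ 2 : ℝ) : 𝕜)) v
      = fourthForm τ₂ τ₃ τ₄ x v := by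
  rw [quadRe_add, quadRe_add, quadRe_smul, quadRe_smul, quadRe_smul, quadRe_one, quadRe_outer,
    quadRe_diagonal, fourthForm]
  simp only [RCLike.ofReal_re]

theorem measurement_nonneg (a v : EuclideanSpace 𝕜 (Fin d)) : 0 ≤ measurement a v :=
  sq_nonneg _

theorem measurement_smul (a v : EuclideanSpace 𝕜 (Fin d)) (t : 𝕜) :
    measurement a (t • v) = ‖t‖ ^ 2 * measurement a v := by
  rw [measurement, inner_smul_right, norm_mul, mul_pow, measurement]

theorem measurement_single (a : EuclideanSpace 𝕜 (Fin d)) (k : Fin d) :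
    measurement a (EuclideanSpace.single k 1) = ‖a k‖ ^ 2 := by
  rw [measurement, EuclideanSpace.inner_single_right]
  simp

theorem measurable_measurement (v : EuclideanSpace 𝕜 (Fin d)) :
    Measurable fun a => measurement a v := by
  unfold measurement
  fun_prop

theorem norm_outer_apply_le (a : EuclideanSpace 𝕜 (Fin d)) (k m : Fin d) :
    ‖outer a k m‖ ≤ measurement a (EuclideanSpace.single k 1)
      + measurement a (EuclideanSpace.single m 1) := by
  rw [measurement_single, measurement_single, outer, Matrix.vecMulVec_apply, norm_mul,
    Pi.star_apply, norm_star]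
  nlinarith [sq_nonneg (‖a k‖ - ‖a m‖), sq_nonneg (‖a k‖ + ‖a m‖)]

theorem measurable_outer_apply (k m : Fin d) :
    Measurable fun a : EuclideanSpace 𝕜 (Fin d) => outer a k m := by
  simp only [outer, Matrix.vecMulVec_apply, Pi.star_apply]
  have hcont : Continuous fun a : EuclideanSpace 𝕜 (Fin d) => a k * star (a m) := by fun_prop
  exact hcont.measurable

theorem exists_norm_one_smul_eq {E : Type*} [NormedAddCommGroup E] [NormedSpace 𝕜 E] [Nontrivial E]
    (x : E) : ∃ e : E, ‖e‖ = 1 ∧ x = (‖x‖ : 𝕜) • e := by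
  rcases eq_or_ne x 0 with rfl | hx
  · obtain ⟨y, hy⟩ := exists_ne (0 : E)
    exact ⟨((‖y‖⁻¹ : ℝ) : 𝕜) • y, by simp [norm_smul, hy], by simp⟩
  · refine ⟨((‖x‖⁻¹ : ℝ) : 𝕜) • x, by simp [norm_smul, hx], ?_⟩
    rw [smul_smul, ← RCLike.ofReal_mul, mul_inv_cancel₀ (norm_ne_zero_iff.2 hx)]
    simp

end QuadForm

/-! ### The moment condition as scalar identities. -/

section Moments

variable {𝕜 : Type*} [RCLike 𝕜] {d : ℕ} {Ω : Type*} [MeasurableSpace Ω] {μ : Measure Ω}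

theorem quadRe_matrixExpectation {X : Ω → Matrix (Fin d) (Fin d) 𝕜}
    (hX : ∀ k m, Integrable (fun ω => X ω k m) μ) (v : EuclideanSpace 𝕜 (Fin d)) :
    quadRe (matrixExpectation X μ) v = ∫ ω, quadRe (X ω) v ∂μ := by
  simp only [quadRe_eq_sum, matrixExpectation, Matrix.of_apply]
  have h : ∀ k m, Integrable (fun ω => RCLike.re (star (v k) * v m * X ω k m)) μ :=
    fun k m => ((hX k m).const_mul _).re
  rw [integral_finsetSum _ fun k _ => integrable_finsetSum _ fun m _ => h k m]
  refine Finset.sum_congr rfl fun k _ => ?_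
  rw [integral_finsetSum _ fun m _ => h k m]
  refine Finset.sum_congr rfl fun m _ => ?_
  rw [integral_re ((hX k m).const_mul _), integral_const_mul]

variable {S : ℝ} {a : Ω → EuclideanSpace 𝕜 (Fin d)}

theorem integrable_measurement_mul [Nontrivial (EuclideanSpace 𝕜 (Fin d))] (hS : 0 < S)
    (ha : Measurable a)
    (hexp : ∀ v : EuclideanSpace 𝕜 (Fin d), ‖v‖ = 1 →
      HasExpMoment S (fun ω => measurement (a ω) v) μ) (x v : EuclideanSpace 𝕜 (Fin d)) :
    Integrable (fun ω => measurement (a ω) x * measurement (a ω) v) μ := by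
  obtain ⟨e, he, hx⟩ := exists_norm_one_smul_eq (𝕜 := 𝕜) x
  obtain ⟨f, hf, hv⟩ := exists_norm_one_smul_eq (𝕜 := 𝕜) v
  rw [hx, hv]
  simp only [measurement_smul]
  have := (hexp e he).integrable_mul hS (hexp f hf) ((measurable_measurement e).comp ha)
    ((measurable_measurement f).comp ha) (fun _ => measurement_nonneg _ _)
    (fun _ => measurement_nonneg _ _)
  convert this.const_mul (‖(‖x‖ : 𝕜)‖ ^ 2 * ‖(‖v‖ : 𝕜)‖ ^ 2) using 2 with ω
  ring

variable {τ₁ τ₂ τ₃ τ₄ : ℝ}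

/-- The matrix identity of (II), tested on `v`: the form is linear in the matrix and so commutes
with the entrywise expectation, which is legitimate because `|A_km| ≤ |a_k|² + |a_m|²` makes the
entries integrable. -/
theorem ConditionII.integral_mul_eq [Nontrivial (EuclideanSpace 𝕜 (Fin d))]
    (h : ConditionII a μ τ₁ τ₂ τ₃ τ₄) (hS : 0 < S) (ha : Measurable a)
    (hexp : ∀ v : EuclideanSpace 𝕜 (Fin d), ‖v‖ = 1 →
      HasExpMoment S (fun ω => measurement (a ω) v) μ) (x v : EuclideanSpace 𝕜 (Fin d)) :
    ∫ ω, measurement (a ω) x * measurement (a ω) v ∂μ = fourthForm τ₂ τ₃ τ₄ x v := by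
  rw [← quadRe_fourth_eq, ← h.fourth x, quadRe_matrixExpectation]
  · simp only [quadRe_smul, quadRe_outer]
  · intro k m
    have hm1 : Measurable fun ω => ((measurement (a ω) x : ℝ) : 𝕜) :=
      RCLike.measurable_ofReal.comp ((measurable_measurement x).comp ha)
    have hm2 : Measurable fun ω => outer (a ω) k m := (measurable_outer_apply k m).comp ha
    refine ((integrable_measurement_mul hS ha hexp x (EuclideanSpace.single k 1)).add
      (integrable_measurement_mul hS ha hexp x (EuclideanSpace.single m 1))).mono'
      (hm1.mul hm2).aestronglyMeasurable (ae_of_all _ fun ω => ?_)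
    rw [Matrix.smul_apply, smul_eq_mul, norm_mul, RCLike.norm_ofReal,
      abs_of_nonneg (measurement_nonneg _ _), Pi.add_apply, ← mul_add]
    exact mul_le_mul_of_nonneg_left (norm_outer_apply_le _ _ _) (measurement_nonneg _ _)

theorem ConditionII.integral_measurement_eq (h : ConditionII a μ τ₁ τ₂ τ₃ τ₄) (hS : 0 < S)
    (ha : Measurable a)
    (hexp : ∀ v : EuclideanSpace 𝕜 (Fin d), ‖v‖ = 1 →
      HasExpMoment S (fun ω => measurement (a ω) v) μ) (v : EuclideanSpace 𝕜 (Fin d)) :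
    ∫ ω, measurement (a ω) v ∂μ = τ₁ * ‖v‖ ^ 2 := by
  rw [← quadRe_one (𝕜 := 𝕜), ← quadRe_smul, ← h.second, quadRe_matrixExpectation]
  · simp only [quadRe_outer]
  · intro k m
    have hi : ∀ k : Fin d, Integrable
        (fun ω => measurement (a ω) (EuclideanSpace.single k (1 : 𝕜))) μ := fun k =>
      (hexp _ (by simp)).integrable_self hS ((measurable_measurement _).comp ha)
        fun _ => measurement_nonneg _ _
    exact ((hi k).add (hi m)).mono' ((measurable_outer_apply k m).comp ha).aestronglyMeasurable
      (ae_of_all _ fun ω => norm_outer_apply_le _ _ _)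

theorem ConditionII.integral_sub_sq_eq [Nontrivial (EuclideanSpace 𝕜 (Fin d))]
    (h : ConditionII a μ τ₁ τ₂ τ₃ τ₄) (hS : 0 < S) (ha : Measurable a)
    (hexp : ∀ v : EuclideanSpace 𝕜 (Fin d), ‖v‖ = 1 →
      HasExpMoment S (fun ω => measurement (a ω) v) μ) (x v : EuclideanSpace 𝕜 (Fin d)) :
    Integrable (fun ω => (measurement (a ω) x - measurement (a ω) v) ^ 2) μ ∧
    ∫ ω, (measurement (a ω) x - measurement (a ω) v) ^ 2 ∂μ
      = fourthForm τ₂ τ₃ τ₄ x x - 2 * fourthForm τ₂ τ₃ τ₄ x v + fourthForm τ₂ τ₃ τ₄ v v := by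
  have i := integrable_measurement_mul hS ha hexp
  have e : (fun ω => (measurement (a ω) x - measurement (a ω) v) ^ 2) = fun ω =>
      measurement (a ω) x * measurement (a ω) x - 2 * (measurement (a ω) x * measurement (a ω) v)
        + measurement (a ω) v * measurement (a ω) v := by
    funext ω
    ring
  have hsub : Integrable (fun ω => measurement (a ω) x * measurement (a ω) x
      - 2 * (measurement (a ω) x * measurement (a ω) v)) μ := (i x x).sub ((i x v).const_mul 2)
  rw [e]
  refine ⟨hsub.add (i v v), ?_⟩
  rw [integral_add hsub (i v v), integral_sub (i x x) ((i x v).const_mul 2),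
    integral_const_mul, h.integral_mul_eq hS ha hexp, h.integral_mul_eq hS ha hexp,
    h.integral_mul_eq hS ha hexp]

end Moments

/-! ### Admissibility of the constants. -/

section Parameters

variable {𝕜 : Type*} [RCLike 𝕜] {d : ℕ} {Ω : Type*} [MeasurableSpace Ω] {μ : Measure Ω}
  {S : ℝ} {a : Ω → EuclideanSpace 𝕜 (Fin d)} {τ₁ τ₂ τ₃ τ₄ : ℝ}

/-- Polarization: it exposes the real part of an off-diagonal entry to the scalar moment identities.
-/
theorem measurement_single_add_sub (a : EuclideanSpace 𝕜 (Fin d)) {k l : Fin d} (hkl : k ≠ l) :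
    measurement a (EuclideanSpace.single k 1 + EuclideanSpace.single l 1)
      - measurement a (EuclideanSpace.single k 1 - EuclideanSpace.single l 1)
      = 4 * RCLike.re ((outer a - diagPart (outer a)) k l) := by
  rw [measurement, measurement, inner_add_right, inner_sub_right,
    EuclideanSpace.inner_single_right, EuclideanSpace.inner_single_right, Matrix.sub_apply,
    diagPart, Matrix.diagonal_apply_ne _ hkl, outer, Matrix.vecMulVec_apply, sub_zero, one_mul,
    one_mul]
  rw [norm_add_sq (𝕜 := 𝕜), norm_sub_sq (𝕜 := 𝕜), RCLike.inner_apply, Pi.star_apply,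
    RCLike.star_def, RCLike.conj_conj]
  rw [mul_comm (starRingEnd 𝕜 (a.ofLp l))]
  ring

theorem ConditionI.two_le [NeZero μ] (h : ConditionI a μ) : 2 ≤ d := by
  obtain ⟨ω, hω⟩ := h.not_imaginary.exists
  by_contra! hd
  refine hω fun k m => ?_
  have : k = m := by
    apply Fin.ext
    omega
  subst this
  simp [diagPart]

theorem fourthForm_single (k l : Fin d) :
    fourthForm τ₂ τ₃ τ₄ (EuclideanSpace.single k (1 : 𝕜)) (EuclideanSpace.single l (1 : 𝕜))
      = τ₂ + if k = l then τ₃ + τ₄ else 0 := by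
  rw [fourthForm, measurement_single]
  by_cases hkl : k = l
  · subst hkl
    simp [ite_pow, apply_ite]
    ring
  · simp [hkl, ite_pow, apply_ite, Ne.symm hkl]

theorem measurement_self (x : EuclideanSpace 𝕜 (Fin d)) : measurement x x = ‖x‖ ^ 4 := by
  rw [measurement, inner_self_eq_norm_sq_to_K, ← RCLike.ofReal_pow, RCLike.norm_ofReal,
    abs_of_nonneg (by positivity)]
  ring

/-- The vectors `p` and `m` are orthogonal with entries of equal modulus, so the `τ₂` and `τ₄`
contributions cancel and only `τ₃(‖p‖⁴ + ‖m‖⁴)` survives. Together with the polarization identity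
this makes `τ₃` a positive multiple of the second moment of the real part of an off-diagonal entry.
-/
theorem fourthForm_single_add_sub {k l : Fin d} (hkl : k ≠ l) {p m : EuclideanSpace 𝕜 (Fin d)}
    (hp : p = EuclideanSpace.single k 1 + EuclideanSpace.single l 1)
    (hm : m = EuclideanSpace.single k 1 - EuclideanSpace.single l 1) :
    fourthForm τ₂ τ₃ τ₄ p p - 2 * fourthForm τ₂ τ₃ τ₄ p m + fourthForm τ₂ τ₃ τ₄ m m = 8 * τ₃ := by
  have hc : ∀ i, ‖m i‖ = ‖p i‖ := by
    intro i
    rcases eq_or_ne i k with rfl | hi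
    · simp [hp, hm, hkl]
    · simp [hp, hm, hi]
  have hnp : ‖p‖ ^ 2 = 2 := by
    rw [hp, norm_add_sq (𝕜 := 𝕜), EuclideanSpace.inner_single_right]
    simp [hkl]
    norm_num
  have hnm : ‖m‖ ^ 2 = 2 := by
    rw [hm, norm_sub_sq (𝕜 := 𝕜), EuclideanSpace.inner_single_right]
    simp [hkl]
    norm_num
  have hpm : measurement p m = 0 := by
    rw [measurement, hp, hm]
    simp [inner_sub_right, inner_add_left, EuclideanSpace.inner_single_right, hkl, hkl.symm]
  simp only [fourthForm, hc, hnp, hnm, hpm, measurement_self]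
  have h4 : ∀ r : ℝ, r ^ 4 = (r ^ 2) ^ 2 := fun r => by ring
  rw [h4, h4, hnp, hnm]
  ring

theorem ConditionI.false_of_ae_eq [NeZero μ] (h : ConditionI a μ)
    (heq : ∀ k l : Fin d, ∀ᵐ ω ∂μ, measurement (a ω) (EuclideanSpace.single k 1)
      = measurement (a ω) (EuclideanSpace.single l 1)) : False := by
  have hall : ∀ᵐ ω ∂μ, ∀ k l : Fin d, measurement (a ω) (EuclideanSpace.single k 1)
      = measurement (a ω) (EuclideanSpace.single l 1) :=
    ae_all_iff.2 fun k => ae_all_iff.2 fun l => heq k l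
  have hd := h.two_le
  obtain ⟨ω, hω, hns⟩ := (hall.and h.not_scalar).exists
  refine hns ((‖a ω ⟨0, by omega⟩‖ ^ 2 : ℝ) : 𝕜) ?_
  rw [diagPart, Matrix.smul_one_eq_diagonal]
  congr 1
  funext k
  have := hω k ⟨0, by omega⟩
  rw [measurement_single, measurement_single] at this
  rw [← this, Matrix.diag_apply, outer, Matrix.vecMulVec_apply, Pi.star_apply, RCLike.star_def,
    RCLike.mul_conj]
  push_cast
  rfl

theorem ae_eq_of_integral_sub_sq_le {f g : Ω → ℝ} (hi : Integrable (fun ω => (f ω - g ω) ^ 2) μ)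
    (h : ∫ ω, (f ω - g ω) ^ 2 ∂μ ≤ 0) : ∀ᵐ ω ∂μ, f ω = g ω := by
  have h0 := (integral_eq_zero_iff_of_nonneg (fun ω => sq_nonneg (f ω - g ω)) hi).1
    (le_antisymm h (integral_nonneg fun ω => sq_nonneg (f ω - g ω)))
  filter_upwards [h0] with ω hω
  exact sub_eq_zero.1 (pow_eq_zero_iff two_ne_zero |>.1 hω)

/-- The nondegeneracy conditions force the constants of the moment condition to be admissible. -/
theorem ConditionI.parameters [NeZero μ] [Nontrivial (EuclideanSpace 𝕜 (Fin d))]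
    (h₁ : ConditionI a μ) (h₂ : ConditionII a μ τ₁ τ₂ τ₃ τ₄) (hS : 0 < S) (ha : Measurable a)
    (hexp : ∀ v : EuclideanSpace 𝕜 (Fin d), ‖v‖ = 1 →
      HasExpMoment S (fun ω => measurement (a ω) v) μ) :
    τ₁ ≠ 0 ∧ 0 < τ₃ ∧ τ₃ + τ₄ ≠ 0 := by
  refine ⟨?_, ?_, ?_⟩
  · intro h0
    have hz : ∀ k : Fin d,
        ∀ᵐ ω ∂μ, measurement (a ω) (EuclideanSpace.single k (1 : 𝕜)) = 0 := by
      intro k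
      have hm := h₂.integral_measurement_eq hS ha hexp (EuclideanSpace.single k 1)
      rw [h0, zero_mul, integral_eq_zero_iff_of_nonneg (fun _ => measurement_nonneg _ _)
        ((hexp _ (by simp)).integrable_self hS ((measurable_measurement _).comp ha)
          fun _ => measurement_nonneg _ _)] at hm
      exact hm
    refine h₁.false_of_ae_eq fun k l => ?_
    filter_upwards [hz k, hz l] with ω hk hl
    rw [hk, hl]
  -- If `τ₃ ≤ 0`, the second moment `8τ₃` vanishes and the off-diagonal part is almost surely purely
  -- imaginary.
  · by_contra! h0
    have hz : ∀ k l : Fin d, ∀ᵐ ω ∂μ,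
        RCLike.re ((outer (a ω) - diagPart (outer (a ω))) k l) = 0 := by
      intro k l
      rcases eq_or_ne k l with rfl | hkl
      · exact ae_of_all _ fun ω => by simp [diagPart]
      · obtain ⟨hi, he⟩ := h₂.integral_sub_sq_eq hS ha hexp
          (EuclideanSpace.single k 1 + EuclideanSpace.single l 1)
          (EuclideanSpace.single k 1 - EuclideanSpace.single l 1)
        rw [fourthForm_single_add_sub hkl rfl rfl] at he
        filter_upwards [ae_eq_of_integral_sub_sq_le hi (by linarith)] with ω hω
        have := measurement_single_add_sub (a ω) hkl
        linarith
    obtain ⟨ω, hω, hni⟩ :=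
      ((ae_all_iff.2 fun k => ae_all_iff.2 fun l => hz k l).and h₁.not_imaginary).exists
    exact hni hω
  -- The difference of two distinct diagonal entries has second moment `2(τ₃+τ₄)`; if this is zero,
  -- the diagonal is almost surely scalar.
  · intro h0
    refine h₁.false_of_ae_eq fun k l => ?_
    obtain ⟨hi, he⟩ := h₂.integral_sub_sq_eq hS ha hexp
      (EuclideanSpace.single k 1) (EuclideanSpace.single l 1)
    rw [fourthForm_single, fourthForm_single, fourthForm_single, h0] at he
    refine ae_eq_of_integral_sub_sq_le hi (he.trans ?_).le
    simp
    ring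

end Parameters

/-! ### Perturbation of the top eigenvector. -/

section Spectral

variable {𝕜 : Type*} [RCLike 𝕜] {d N : ℕ}

/-- For a Hermitian matrix the supremum of the Rayleigh quotient is itself an eigenvalue, hence at
most `l`. -/
theorem quadRe_le_of_isGreatest {A : Matrix (Fin d) (Fin d) 𝕜} (hA : A.IsHermitian) {l : ℝ}
    (hl : IsGreatest {t : ℝ | Module.End.HasEigenvalue (Matrix.toLin' A) (t : 𝕜)} l)
    {w : EuclideanSpace 𝕜 (Fin d)} (hw : ‖w‖ = 1) : quadRe A w ≤ l := by
  have hw0 : w ≠ 0 := fun h => by simp [h] at hw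
  have : Nontrivial (EuclideanSpace 𝕜 (Fin d)) := ⟨w, 0, hw0⟩
  set T := Matrix.toEuclideanLin A with hT
  have hsymm : T.IsSymmetric := Matrix.isSymmetric_toEuclideanLin_iff.2 hA
  have heig := hsymm.hasEigenvalue_iSup_of_finiteDimensional
  set t : ℝ := ⨆ x : { x : EuclideanSpace 𝕜 (Fin d) // x ≠ 0 },
    RCLike.re (inner 𝕜 (T x) (x : EuclideanSpace 𝕜 (Fin d))) /
      ‖(x : EuclideanSpace 𝕜 (Fin d))‖ ^ 2 with ht
  have htl : t ≤ l := by
    refine hl.2 ?_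
    obtain ⟨v, hv⟩ := heig.exists_hasEigenvector
    refine Module.End.hasEigenvalue_of_hasEigenvector (x := v.ofLp) ⟨?_, ?_⟩
    · rw [Module.End.mem_eigenspace_iff, Matrix.toLin'_apply]
      exact congrArg WithLp.ofLp hv.apply_eq_smul
    · intro h
      exact hv.2 (by ext i; exact congrFun h i)
  refine le_trans ?_ htl
  have hbdd : BddAbove (Set.range fun x : { x : EuclideanSpace 𝕜 (Fin d) // x ≠ 0 } =>
      RCLike.re (inner 𝕜 (T x) (x : EuclideanSpace 𝕜 (Fin d))) /
        ‖(x : EuclideanSpace 𝕜 (Fin d))‖ ^ 2) := by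
    refine ⟨‖T.toContinuousLinearMap‖, ?_⟩
    rintro _ ⟨⟨x, hx⟩, rfl⟩
    have hx' : 0 < ‖x‖ := norm_pos_iff.2 hx
    rw [div_le_iff₀ (by positivity)]
    refine (RCLike.re_le_norm _).trans ((norm_inner_le_norm _ _).trans ?_)
    have := T.toContinuousLinearMap.le_opNorm x
    rw [sq, ← mul_assoc]
    exact mul_le_mul_of_nonneg_right this hx'.le
  have := le_ciSup hbdd ⟨w, hw0⟩
  simp only [hw, one_pow, div_one] at this
  rwa [inner_re_symm, hT, ← quadRe_eq_re_inner] at this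

theorem isHermitian_outer (a : EuclideanSpace 𝕜 (Fin d)) : (outer a).IsHermitian := by
  ext k m
  simp [outer, Matrix.vecMulVec_apply, mul_comm]

theorem isHermitian_ofReal_smul {A : Matrix (Fin d) (Fin d) 𝕜} (hA : A.IsHermitian) (t : ℝ) :
    ((t : 𝕜) • A).IsHermitian := by
  rw [Matrix.IsHermitian, Matrix.conjTranspose_smul, hA.eq, RCLike.star_def, RCLike.conj_ofReal]

theorem isHermitian_diagPart {A : Matrix (Fin d) (Fin d) 𝕜} (hA : A.IsHermitian) :
    (diagPart A).IsHermitian := by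
  refine Matrix.isHermitian_diagonal_iff.2 fun k => ?_
  exact hA.apply k k

theorem isHermitian_matY (a : Fin N → EuclideanSpace 𝕜 (Fin d)) (x : EuclideanSpace 𝕜 (Fin d)) :
    (matY a x).IsHermitian := by
  refine isHermitian_ofReal_smul ?_ _
  rw [Matrix.IsHermitian, Matrix.conjTranspose_sum]
  exact Finset.sum_congr rfl fun j _ => isHermitian_ofReal_smul (isHermitian_outer _) _

theorem isHermitian_matM (τ₁ τ₂ τ₃ τ₄ : ℝ) (a : Fin N → EuclideanSpace 𝕜 (Fin d))
    (x : EuclideanSpace 𝕜 (Fin d)) : (matM τ₁ τ₂ τ₃ τ₄ a x).IsHermitian :=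
  (isHermitian_matY a x).sub (isHermitian_ofReal_smul (isHermitian_diagPart
    ((isHermitian_matY a x).sub (isHermitian_ofReal_smul Matrix.isHermitian_one _))) _)

theorem re_diag_eq_quadRe (A : Matrix (Fin d) (Fin d) 𝕜) (k : Fin d) :
    RCLike.re (A k k) = quadRe A (EuclideanSpace.single k 1) := by
  simp [quadRe, dotProduct, Matrix.mulVec, Pi.single_apply, apply_ite]

/-- Diagonal entries are values of the form at basis vectors, so `hY` controls them as well. The
weights `‖w k‖²` sum to one, so the diagonal correction costs a factor independent of `d`. -/
theorem abs_quadRe_matM_sub_le {τ₁ τ₂ τ₃ τ₄ δ : ℝ} (hτ : τ₃ + τ₄ ≠ 0)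
    {a : Fin N → EuclideanSpace 𝕜 (Fin d)} {x : EuclideanSpace 𝕜 (Fin d)}
    (hY : ∀ w : EuclideanSpace 𝕜 (Fin d), ‖w‖ = 1 →
      |quadRe (matY a x) w - fourthForm τ₂ τ₃ τ₄ x w| ≤ δ * ‖x‖ ^ 2)
    (hρ : |rhoSq τ₁ a x - ‖x‖ ^ 2| ≤ δ * ‖x‖ ^ 2)
    {w : EuclideanSpace 𝕜 (Fin d)} (hw : ‖w‖ = 1) :
    |quadRe (matM τ₁ τ₂ τ₃ τ₄ a x) w - (τ₂ * ‖x‖ ^ 2 + τ₃ * measurement x w)|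
      ≤ δ * (1 + |τ₄ / (τ₃ + τ₄)| * (1 + |τ₂|)) * ‖x‖ ^ 2 := by
  set κ := τ₄ / (τ₃ + τ₄) with hκ
  set r := rhoSq τ₁ a x
  set D : Fin d → ℝ := fun k => RCLike.re (matY a x k k) - τ₂ * r with hD
  have hM : quadRe (matM τ₁ τ₂ τ₃ τ₄ a x) w = quadRe (matY a x) w - κ * ∑ k, D k * ‖w k‖ ^ 2 := by
    rw [matM, quadRe_sub, quadRe_smul, diagPart, quadRe_diagonal]
    congr 2
    refine Finset.sum_congr rfl fun k _ => ?_
    rw [hD, Matrix.diag_apply, Matrix.sub_apply, Matrix.smul_apply, Matrix.one_apply_eq,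
      smul_eq_mul, mul_one, map_sub, RCLike.ofReal_re]
  have hwk : ∑ k, ‖w k‖ ^ 2 = 1 := by
    rw [← EuclideanSpace.norm_sq_eq, hw, one_pow]
  have hDk : ∀ k, |D k - (τ₃ + τ₄) * ‖x k‖ ^ 2| ≤ δ * (1 + |τ₂|) * ‖x‖ ^ 2 := by
    intro k
    have h1 := hY (EuclideanSpace.single k 1) (by simp)
    have hf : fourthForm τ₂ τ₃ τ₄ x (EuclideanSpace.single k 1)
        = τ₂ * ‖x‖ ^ 2 + (τ₃ + τ₄) * ‖x k‖ ^ 2 := by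
      rw [fourthForm, measurement_single]
      simp [ite_pow, apply_ite]
      ring
    rw [← re_diag_eq_quadRe, hf] at h1
    have e : D k - (τ₃ + τ₄) * ‖x k‖ ^ 2
        = (RCLike.re (matY a x k k) - (τ₂ * ‖x‖ ^ 2 + (τ₃ + τ₄) * ‖x k‖ ^ 2))
          - τ₂ * (r - ‖x‖ ^ 2) := by
      rw [hD]
      ring
    rw [e]
    refine (abs_sub _ _).trans ?_
    rw [abs_mul]
    have := mul_le_mul_of_nonneg_left hρ (abs_nonneg τ₂)
    linarith
  have hsum : |∑ k, D k * ‖w k‖ ^ 2 - (τ₃ + τ₄) * ∑ k, ‖x k‖ ^ 2 * ‖w k‖ ^ 2|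
      ≤ δ * (1 + |τ₂|) * ‖x‖ ^ 2 := by
    rw [Finset.mul_sum, ← Finset.sum_sub_distrib]
    refine (Finset.abs_sum_le_sum_abs _ _).trans ?_
    calc ∑ k, |D k * ‖w k‖ ^ 2 - (τ₃ + τ₄) * (‖x k‖ ^ 2 * ‖w k‖ ^ 2)|
        ≤ ∑ k, (δ * (1 + |τ₂|) * ‖x‖ ^ 2) * ‖w k‖ ^ 2 := by
          refine Finset.sum_le_sum fun k _ => ?_
          rw [← mul_assoc, ← sub_mul, abs_mul, abs_of_nonneg (sq_nonneg ‖w k‖)]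
          exact mul_le_mul_of_nonneg_right (hDk k) (sq_nonneg _)
      _ = δ * (1 + |τ₂|) * ‖x‖ ^ 2 := by rw [← Finset.mul_sum, hwk, mul_one]
  have hYw := hY w hw
  rw [fourthForm, hw] at hYw
  have e : quadRe (matM τ₁ τ₂ τ₃ τ₄ a x) w - (τ₂ * ‖x‖ ^ 2 + τ₃ * measurement x w)
      = (quadRe (matY a x) w - (τ₂ * ‖x‖ ^ 2 * 1 ^ 2 + τ₃ * measurement x w
          + τ₄ * ∑ k, ‖x k‖ ^ 2 * ‖w k‖ ^ 2))
        - κ * (∑ k, D k * ‖w k‖ ^ 2 - (τ₃ + τ₄) * ∑ k, ‖x k‖ ^ 2 * ‖w k‖ ^ 2) := by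
    have hκ' : κ * (τ₃ + τ₄) = τ₄ := div_mul_cancel₀ _ hτ
    rw [hM, mul_sub, ← mul_assoc κ, hκ']
    ring
  rw [e]
  refine (abs_sub _ _).trans ?_
  rw [abs_mul]
  have := mul_le_mul_of_nonneg_left hsum (abs_nonneg κ)
  linarith

theorem exists_phase (e v : EuclideanSpace 𝕜 (Fin d)) (he : ‖e‖ = 1) (hv : ‖v‖ = 1) :
    ∃ u : 𝕜, ‖u‖ = 1 ∧ ‖v - u • e‖ ^ 2 = 2 - 2 * ‖(inner 𝕜 e v : 𝕜)‖ := by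
  obtain ⟨u, hu, hue⟩ : ∃ u : 𝕜, ‖u‖ = 1 ∧ u * inner 𝕜 v e = ‖(inner 𝕜 e v : 𝕜)‖ := by
    rcases eq_or_ne (inner 𝕜 v e : 𝕜) 0 with h | h
    · refine ⟨1, by simp, ?_⟩
      rw [norm_inner_symm, h]
      simp
    · have hn : ‖(inner 𝕜 v e : 𝕜)‖ ≠ 0 := norm_ne_zero_iff.2 h
      have hn' : ((‖(inner 𝕜 v e : 𝕜)‖ : ℝ) : 𝕜) ≠ 0 := by exact_mod_cast hn
      refine ⟨star (inner 𝕜 v e : 𝕜) / (‖(inner 𝕜 v e : 𝕜)‖ : 𝕜), ?_, ?_⟩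
      · rw [norm_div, norm_star, RCLike.norm_ofReal, abs_norm, div_self hn]
      · rw [div_mul_eq_mul_div, RCLike.star_def, RCLike.conj_mul, norm_inner_symm e v, sq,
          mul_div_assoc, div_self hn', mul_one]
  refine ⟨u, hu, ?_⟩
  rw [norm_sub_sq (𝕜 := 𝕜), inner_smul_right, hue, norm_smul, hu, he, hv, RCLike.ofReal_re]
  ring

theorem phaseDist_le_of_isSpectralInit {τ₁ τ₂ τ₃ τ₄ δ η ε : ℝ} (hτ : τ₃ + τ₄ ≠ 0) (hτ₃ : 0 < τ₃)
    (hδ1 : δ ≤ 1) (hη : 0 ≤ η)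
    (hδη : 4 * (δ * (1 + |τ₄ / (τ₃ + τ₄)| * (1 + |τ₂|))) ≤ τ₃ * η ^ 2) (hε : δ + η ≤ ε)
    {a : Fin N → EuclideanSpace 𝕜 (Fin d)} {x z₀ : EuclideanSpace 𝕜 (Fin d)}
    (hY : ∀ w : EuclideanSpace 𝕜 (Fin d), ‖w‖ = 1 →
      |quadRe (matY a x) w - fourthForm τ₂ τ₃ τ₄ x w| ≤ δ * ‖x‖ ^ 2)
    (hρ : |rhoSq τ₁ a x - ‖x‖ ^ 2| ≤ δ * ‖x‖ ^ 2)
    (hz : IsSpectralInit τ₁ τ₂ τ₃ τ₄ a x z₀) : phaseDist z₀ x ≤ ε * ‖x‖ := by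
  obtain ⟨l, v, hl, hlv, hv, rfl⟩ := hz
  set r := rhoSq τ₁ a x
  have hbdd : BddBelow (Set.range fun u : Metric.sphere (0 : 𝕜) 1 =>
      ‖((Real.sqrt r : ℝ) : 𝕜) • v - (u : 𝕜) • x‖) :=
    ⟨0, by rintro _ ⟨u, rfl⟩; exact norm_nonneg _⟩
  suffices ∃ u : 𝕜, ‖u‖ = 1 ∧ ‖((Real.sqrt r : ℝ) : 𝕜) • v - u • x‖ ≤ ε * ‖x‖ by
    obtain ⟨u, hu, h⟩ := this
    exact (ciInf_le hbdd ⟨u, by simpa using hu⟩).trans h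
  have hv0 : v ≠ 0 := fun h => by simp [h] at hv
  have : Nontrivial (EuclideanSpace 𝕜 (Fin d)) := ⟨v, 0, hv0⟩
  obtain ⟨e, he, hxe⟩ := exists_norm_one_smul_eq (𝕜 := 𝕜) x
  rcases eq_or_ne x 0 with hx | hx
  · refine ⟨1, by simp, ?_⟩
    have hr : r = 0 := by simpa [hx] using hρ
    simp [hr, hx]
  have hR : 0 < ‖x‖ := norm_pos_iff.2 hx
  have hM := fun w hw => abs_le.1 (abs_quadRe_matM_sub_le (w := w) hτ hY hρ hw)
  have hle := quadRe_le_of_isGreatest (isHermitian_matM τ₁ τ₂ τ₃ τ₄ a x) hl he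
  have hqv : quadRe (matM τ₁ τ₂ τ₃ τ₄ a x) v = l := by
    rw [quadRe, hlv, dotProduct_smul, smul_eq_mul, RCLike.re_ofReal_mul]
    have : RCLike.re (star v.ofLp ⬝ᵥ v.ofLp) = ‖v‖ ^ 2 := by
      rw [← quadRe_one (𝕜 := 𝕜), quadRe, Matrix.one_mulVec]
    rw [this, hv]
    ring
  have hm : ∀ w, measurement x w = ‖x‖ ^ 2 * ‖(inner 𝕜 e w : 𝕜)‖ ^ 2 := by
    intro w
    conv_lhs => rw [hxe]
    rw [measurement, inner_smul_left, norm_mul, mul_pow]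
    simp
  have hee : ‖(inner 𝕜 e e : 𝕜)‖ = 1 := by
    rw [inner_self_eq_norm_sq_to_K, he]
    simp
  have h1 := (hM e he).1
  have h2 := (hM v hv).2
  rw [hm, hee] at h1
  rw [hm, hqv] at h2
  set c := ‖(inner 𝕜 e v : 𝕜)‖ with hc
  set δ' := δ * (1 + |τ₄ / (τ₃ + τ₄)| * (1 + |τ₂|))
  have hc1 : c ≤ 1 := by
    have := norm_inner_le_norm (𝕜 := 𝕜) e v
    rwa [he, hv, one_mul] at this
  -- Chain `M(e) ≤ l = M(v)` with the two approximations: the `τ₂` terms cancel and the spectral gap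
  -- `τ₃` bounds `1 - c²`.
  have hkey : τ₃ * (1 - c ^ 2) ≤ 2 * δ' := by
    have : ‖x‖ ^ 2 * (τ₃ * (1 - c ^ 2)) ≤ ‖x‖ ^ 2 * (2 * δ') := by linarith
    exact le_of_mul_le_mul_left this (by positivity)
  obtain ⟨u, hu, hd⟩ := exists_phase e v he hv
  refine ⟨u, hu, ?_⟩
  have hvu : ‖v - u • e‖ ≤ η := by
    refine abs_le_of_sq_le_sq' ?_ hη |>.2
    rw [hd, ← hc]
    have hc2 : c ^ 2 ≤ c := by nlinarith [norm_nonneg (inner 𝕜 e v : 𝕜)]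
    refine le_of_mul_le_mul_left ?_ hτ₃
    nlinarith
  have hr0 : 0 ≤ r := by nlinarith [(abs_le.1 hρ).1, sq_nonneg ‖x‖]
  -- Dividing `|r - ‖x‖²|` by `√r + ‖x‖ ≥ ‖x‖` turns the relative error of `ρ²` into one of `ρ`.
  have hsqrt : |Real.sqrt r - ‖x‖| ≤ δ * ‖x‖ := by
    have e1 : r - ‖x‖ ^ 2 = (Real.sqrt r - ‖x‖) * (Real.sqrt r + ‖x‖) := by
      nlinarith [Real.sq_sqrt hr0]
    rw [e1, abs_mul, abs_of_nonneg (add_nonneg (Real.sqrt_nonneg r) hR.le)] at hρ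
    have : |Real.sqrt r - ‖x‖| * ‖x‖ ≤ δ * ‖x‖ * ‖x‖ := by
      nlinarith [abs_nonneg (Real.sqrt r - ‖x‖), Real.sqrt_nonneg r]
    exact le_of_mul_le_mul_right this hR
  have hdec : ((Real.sqrt r : ℝ) : 𝕜) • v - u • x
      = ((Real.sqrt r - ‖x‖ : ℝ) : 𝕜) • v + (‖x‖ : 𝕜) • (v - u • e) := by
    conv_lhs => rw [hxe]
    push_cast
    module
  rw [hdec]
  refine (norm_add_le _ _).trans ?_
  rw [norm_smul, norm_smul, RCLike.norm_ofReal, RCLike.norm_ofReal, hv, abs_norm, mul_one]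
  nlinarith

end Spectral

/-! ### The event on which `Y` and `ρ` are close to their means. -/

section Concentration

variable {𝕜 : Type*} [RCLike 𝕜] {d N : ℕ}

theorem quadRe_matY (a : Fin N → EuclideanSpace 𝕜 (Fin d)) (x v : EuclideanSpace 𝕜 (Fin d)) :
    quadRe (matY a x) v = 1 / N * ∑ j, measurement (a j) x * measurement (a j) v := by
  rw [matY, quadRe_smul, quadRe_sum]
  simp only [quadRe_smul, quadRe_outer]

theorem finrank_real_euclideanSpace_le :
    Module.finrank ℝ (EuclideanSpace 𝕜 (Fin d)) ≤ 2 * d := by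
  have h := Module.finrank_mul_finrank ℝ 𝕜 (EuclideanSpace 𝕜 (Fin d))
  rw [finrank_euclideanSpace_fin] at h
  rw [← h]
  exact Nat.mul_le_mul_right _ (RCLike.finrank_le_two 𝕜)

variable {Ω : Type*} [MeasurableSpace Ω] {μ : Measure Ω} [IsProbabilityMeasure μ]
  {a : Fin N → Ω → EuclideanSpace 𝕜 (Fin d)} {τ₁ τ₂ τ₃ τ₄ : ℝ} {S δ T : ℝ}

theorem measureReal_truncMul_deviation_le (hS : 0 < S) (ha : ∀ j, Measurable (a j))
    (hind : iIndepFun a μ)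
    (hexp : ∀ j, ∀ v : EuclideanSpace 𝕜 (Fin d), ‖v‖ = 1 →
      HasExpMoment S (fun ω => measurement (a j ω) v) μ) (hT : 0 < T) {l : ℝ} (hl0 : 0 ≤ l)
    (hl : l ≤ S / (2 * T)) (hlB : 2 * l * (4096 / S ^ 4) ≤ δ)
    {e v : EuclideanSpace 𝕜 (Fin d)} (he : ‖e‖ = 1) (hv : ‖v‖ = 1) :
    μ.real {ω | N * δ ≤ |∑ j, (truncMul T (measurement (a j ω) e) (measurement (a j ω) v)
        - ∫ ω, truncMul T (measurement (a j ω) e) (measurement (a j ω) v) ∂μ)|}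
      ≤ 2 * Real.exp (-(l * δ / 2 * N)) := by
  have hg : Measurable fun b : EuclideanSpace 𝕜 (Fin d) =>
      truncMul T (measurement b e) (measurement b v) :=
    (measurable_truncMul T).comp ((measurable_measurement e).prodMk (measurable_measurement v))
  have hmem := fun j w => (measurable_measurement w).comp (ha j)
  have hB := fun j => (hexp j e he).integral_truncMul_sq_mul_exp_le hS (hexp j v hv) (hmem j e)
    (hmem j v) (fun _ => measurement_nonneg _ _) (fun _ => measurement_nonneg _ _) hT
  have hI := fun j => (hexp j e he).abs_integral_truncMul_sub_le hS (hexp j v hv) (hmem j e)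
    (hmem j v) (fun _ => measurement_nonneg _ _) (fun _ => measurement_nonneg _ _) T
  exact measureReal_abs_sum_sub_integral_ge_le (fun j => hg.comp (ha j))
    (fun j ω => truncMul_nonneg (measurement_nonneg _ _) (measurement_nonneg _ _))
    (hind.comp (fun _ b => truncMul T (measurement b e) (measurement b v)) fun _ => hg)
    (fun j => (hI j).1) (fun j => (hB j).1) (fun j => (hB j).2) hl0 hl hlB

theorem measureReal_measurement_deviation_le (hS : 0 < S) (ha : ∀ j, Measurable (a j))
    (hind : iIndepFun a μ) {e : EuclideanSpace 𝕜 (Fin d)}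
    (hexp : ∀ j, HasExpMoment S (fun ω => measurement (a j ω) e) μ) {l : ℝ} (hl0 : 0 ≤ l)
    (hl : l ≤ S / 2) (hlB : 2 * l * (32 / S ^ 2) ≤ δ) :
    μ.real {ω | N * δ ≤ |∑ j, (measurement (a j ω) e - ∫ ω, measurement (a j ω) e ∂μ)|}
      ≤ 2 * Real.exp (-(l * δ / 2 * N)) := by
  have hmem := fun j => (measurable_measurement e).comp (ha j)
  have hB := fun j => (hexp j).integral_sq_mul_exp_le hS (hmem j) fun _ => measurement_nonneg _ _
  exact measureReal_abs_sum_sub_integral_ge_le hmem (fun j ω => measurement_nonneg _ _)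
    (hind.comp (fun _ b => measurement b e) fun _ => measurable_measurement e)
    (fun j => (hexp j).integrable_self hS (hmem j) fun _ => measurement_nonneg _ _)
    (fun j => (hB j).1) (fun j => (hB j).2) hl0 hl hlB

theorem exists_concentration_event [Nontrivial (EuclideanSpace 𝕜 (Fin d))] (hN : 0 < N)
    (hS : 0 < S) (ha : ∀ j, Measurable (a j)) (hind : iIndepFun a μ)
    (hexp : ∀ j, ∀ v : EuclideanSpace 𝕜 (Fin d), ‖v‖ = 1 →
      HasExpMoment S (fun ω => measurement (a j ω) v) μ)
    (hII : ∀ j, ConditionII (a j) μ τ₁ τ₂ τ₃ τ₄) (hτ₁ : τ₁ ≠ 0)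
    (hT : 0 < T) (hTδ : 64 / S ^ 2 * Real.exp (-(S / 4 * T)) ≤ δ)
    {l : ℝ} (hl0 : 0 ≤ l) (hl : l ≤ S / (2 * T)) (hlB : 2 * l * (4096 / S ^ 4) ≤ δ)
    {l' : ℝ} (hl0' : 0 ≤ l') (hl' : l' ≤ S / 2) (hlB' : 2 * l' * (32 / S ^ 2) ≤ |τ₁| * δ)
    (x : EuclideanSpace 𝕜 (Fin d)) :
    ∃ G : Set Ω, MeasurableSet G ∧
      1 - (N * (2 * Real.exp (-(S * T))) + 25 ^ d * (2 * Real.exp (-(l * δ / 2 * N)))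
        + 2 * Real.exp (-(l' * (|τ₁| * δ) / 2 * N))) ≤ μ.real G ∧
      ∀ ω ∈ G, (∀ w : EuclideanSpace 𝕜 (Fin d), ‖w‖ = 1 →
        |quadRe (matY (fun j => a j ω) x) w - fourthForm τ₂ τ₃ τ₄ x w| ≤ 64 * δ * ‖x‖ ^ 2) ∧
        |rhoSq τ₁ (fun j => a j ω) x - ‖x‖ ^ 2| ≤ δ * ‖x‖ ^ 2 := by
  obtain ⟨e, he, hxe⟩ := exists_norm_one_smul_eq (𝕜 := 𝕜) x
  obtain ⟨s, hscard, hs1, hs⟩ := exists_half_net_sphere (EuclideanSpace 𝕜 (Fin d))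
  have hN' : (0 : ℝ) < N := by exact_mod_cast hN
  set W : EuclideanSpace 𝕜 (Fin d) → Fin N → Ω → ℝ := fun v j ω =>
    truncMul T (measurement (a j ω) e) (measurement (a j ω) v) with hW
  -- Three bad events: some `|a_j*e|²` exceeds `T`, a truncated sum deviates at a net point, or `ρ²`
  -- deviates. Off `B₁` the truncation is inactive.
  set B₁ : Set Ω := ⋃ j, {ω | T < measurement (a j ω) e} with hB₁
  set B₂ : Set Ω := ⋃ c ∈ s, {ω | N * δ ≤ |∑ j, (W c j ω - ∫ ω, W c j ω ∂μ)|} with hB₂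
  set B₃ : Set Ω := {ω | N * (|τ₁| * δ) ≤
    |∑ j, (measurement (a j ω) e - ∫ ω, measurement (a j ω) e ∂μ)|} with hB₃
  have h₁ : μ.real B₁ ≤ N * (2 * Real.exp (-(S * T))) := by
    refine (measureReal_iUnion_fintype_le _).trans ?_
    refine (Finset.sum_le_sum fun j _ => (hexp j e he).measureReal_gt_le hS T).trans ?_
    simp
  have h₂ : μ.real B₂ ≤ 25 ^ d * (2 * Real.exp (-(l * δ / 2 * N))) := by
    refine (measureReal_biUnion_finset_le _ _).trans ?_
    refine (Finset.sum_le_sum fun c hc => measureReal_truncMul_deviation_le hS ha hind hexp hT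
      hl0 hl hlB he (hs1 c hc)).trans ?_
    rw [Finset.sum_const, nsmul_eq_mul]
    refine mul_le_mul_of_nonneg_right ?_ (by positivity)
    -- The real dimension is at most `2d`, and `5^(2d) = 25^d`.
    have : s.card ≤ 25 ^ d := by
      refine hscard.trans ((Nat.pow_le_pow_right (by norm_num)
        finrank_real_euclideanSpace_le).trans ?_)
      rw [pow_mul]
      norm_num
    exact_mod_cast this
  have h₃ : μ.real B₃ ≤ 2 * Real.exp (-(l' * (|τ₁| * δ) / 2 * N)) :=
    measureReal_measurement_deviation_le hS ha hind (fun j => hexp j e he) hl0' hl' hlB'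
  refine ⟨(toMeasurable μ (B₁ ∪ B₂ ∪ B₃))ᶜ, (measurableSet_toMeasurable _ _).compl, ?_, ?_⟩
  · rw [probReal_compl_eq_one_sub (measurableSet_toMeasurable _ _)]
    have : μ.real (toMeasurable μ (B₁ ∪ B₂ ∪ B₃)) = μ.real (B₁ ∪ B₂ ∪ B₃) := by
      rw [measureReal_def, measure_toMeasurable, measureReal_def]
    rw [this]
    have u1 := measureReal_union_le (μ := μ) (B₁ ∪ B₂) B₃
    have u2 := measureReal_union_le (μ := μ) B₁ B₂
    linarith
  intro ω hω
  have hωB : ω ∉ B₁ ∪ B₂ ∪ B₃ := fun h => hω (subset_toMeasurable _ _ h)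
  simp only [Set.mem_union, not_or] at hωB
  obtain ⟨⟨g₁, g₂⟩, g₃⟩ := hωB
  have g₁' : ∀ j, measurement (a j ω) e ≤ T := by
    intro j
    by_contra! h
    exact g₁ (Set.mem_iUnion.2 ⟨j, h⟩)
  -- One `δ` pays for the fluctuation of the truncated sum, the other for the truncation bias; the
  -- net argument then multiplies `2δ` by `32`.
  have hnet : ∀ c ∈ s, |quadRe (matY (fun j => a j ω) e) c - fourthForm τ₂ τ₃ τ₄ e c|
      ≤ 2 * δ := by
    intro c hc
    have g : |∑ j, (W c j ω - ∫ ω, W c j ω ∂μ)| ≤ N * δ := by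
      by_contra! h
      exact g₂ (Set.mem_iUnion₂.2 ⟨c, hc, h.le⟩)
    have hmean : ∀ j, |∫ ω, W c j ω ∂μ - fourthForm τ₂ τ₃ τ₄ e c| ≤ δ := by
      intro j
      have := ((hexp j e he).abs_integral_truncMul_sub_le hS (hexp j c (hs1 c hc))
        ((measurable_measurement e).comp (ha j)) ((measurable_measurement c).comp (ha j))
        (fun _ => measurement_nonneg _ _) (fun _ => measurement_nonneg _ _) T).2
      rw [(hII j).integral_mul_eq hS (ha j) (hexp j)] at this
      exact this.trans hTδ
    have hsum : |∑ j, (∫ ω, W c j ω ∂μ - fourthForm τ₂ τ₃ τ₄ e c)| ≤ N * δ := by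
      refine (Finset.abs_sum_le_sum_abs _ _).trans
        ((Finset.sum_le_sum fun j _ => hmean j).trans ?_)
      simp
    have heq : quadRe (matY (fun j => a j ω) e) c - fourthForm τ₂ τ₃ τ₄ e c
        = 1 / N * (∑ j, (W c j ω - ∫ ω, W c j ω ∂μ)
          + ∑ j, (∫ ω, W c j ω ∂μ - fourthForm τ₂ τ₃ τ₄ e c)) := by
      rw [quadRe_matY, ← Finset.sum_add_distrib]
      simp only [sub_add_sub_cancel, Finset.sum_sub_distrib, Finset.sum_const, Finset.card_univ,
        Fintype.card_fin, nsmul_eq_mul, hW, truncMul, g₁', if_true]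
      field_simp
    rw [heq, abs_mul, abs_of_pos (by positivity), one_div, inv_mul_le_iff₀ hN']
    refine (abs_add_le _ _).trans ?_
    linarith
  have hsq : ‖(‖x‖ : 𝕜)‖ ^ 2 = ‖x‖ ^ 2 := by simp
  have hscale : ∀ b, measurement b x = ‖x‖ ^ 2 * measurement b e := by
    intro b
    conv_lhs => rw [hxe]
    rw [measurement_smul, hsq]
  constructor
  · intro w hw
    have hsphere : |quadRe (matY (fun j => a j ω) e) w - fourthForm τ₂ τ₃ τ₄ e w|
        ≤ 32 * (2 * δ) := by
      have hq := fun v : EuclideanSpace 𝕜 (Fin d) => show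
          quadRe (matY (fun j => a j ω) e) v - fourthForm τ₂ τ₃ τ₄ e v = _ by
        rw [← quadRe_fourth_eq, ← quadRe_sub, quadRe_eq_re_inner]
      simp only [hq] at hnet ⊢
      exact abs_re_inner_le_of_abs_le_on_net _ hs1 hs hnet hw
    have e1 : quadRe (matY (fun j => a j ω) x) w
        = ‖x‖ ^ 2 * quadRe (matY (fun j => a j ω) e) w := by
      rw [quadRe_matY, quadRe_matY]
      simp only [hscale, mul_assoc, ← Finset.mul_sum]
      ring
    have e2 : fourthForm τ₂ τ₃ τ₄ x w = ‖x‖ ^ 2 * fourthForm τ₂ τ₃ τ₄ e w := by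
      have hx : measurement x w = ‖x‖ ^ 2 * measurement e w := by
        conv_lhs => rw [hxe]
        rw [measurement, inner_smul_left, norm_mul, mul_pow, measurement]
        simp
      have hk : ∀ k, ‖x k‖ ^ 2 = ‖x‖ ^ 2 * ‖e k‖ ^ 2 := by
        intro k
        conv_lhs => rw [hxe]
        rw [PiLp.smul_apply, norm_smul, mul_pow, hsq]
      rw [fourthForm, fourthForm, hx, he]
      simp only [hk, mul_assoc, ← Finset.mul_sum]
      ring
    rw [e1, e2, ← mul_sub, abs_mul, abs_of_nonneg (sq_nonneg ‖x‖)]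
    have := mul_le_mul_of_nonneg_left hsphere (sq_nonneg ‖x‖)
    linarith
  · have g : |∑ j, (measurement (a j ω) e - ∫ ω, measurement (a j ω) e ∂μ)|
        ≤ N * (|τ₁| * δ) := by
      by_contra! h
      exact g₃ h.le
    have hm : ∀ j, ∫ ω, measurement (a j ω) e ∂μ = τ₁ := by
      intro j
      rw [(hII j).integral_measurement_eq hS (ha j) (hexp j), he]
      ring
    simp only [hm] at g
    have heq : rhoSq τ₁ (fun j => a j ω) x - ‖x‖ ^ 2
        = ‖x‖ ^ 2 * (1 / (τ₁ * N) * ∑ j, (measurement (a j ω) e - τ₁)) := by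
      rw [rhoSq, Finset.sum_sub_distrib]
      simp only [hscale, ← Finset.mul_sum, Finset.sum_const, Finset.card_univ, Fintype.card_fin,
        nsmul_eq_mul]
      field_simp
    have hb : |1 / (τ₁ * N) * ∑ j, (measurement (a j ω) e - τ₁)| ≤ δ := by
      rw [abs_mul, abs_div, abs_one, abs_mul, abs_of_pos hN', one_div,
        inv_mul_le_iff₀ (by positivity)]
      linarith
    rw [heq, abs_mul, abs_of_nonneg (sq_nonneg ‖x‖), mul_comm δ]
    exact mul_le_mul_of_nonneg_left hb (sq_nonneg _)

end Concentration

/-! ### Sample size and failure probabilities. -/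

section Numerics

/-- Put `r = N/d`. The hypothesis gives `log d ≤ √r`, and `log r ≤ 2√r` always, so `log N ≤ 3√r`; `D
log N ≤ r` then follows from `3D ≤ √r`. Since `log² d ≥ 0.4` for `d ≥ 2`, the chosen constant makes
`r` dominate `9D²`, `N₀` and `4`. -/
theorem exists_const_forall_ge_mul_log (N₀ D : ℝ) (hN₀ : 0 ≤ N₀) :
    ∃ C : ℝ, 0 < C ∧ ∀ d N : ℕ, 2 ≤ d → C * d * Real.log d ^ 2 ≤ N →
      N₀ ≤ N ∧ 3 ≤ N ∧ d ≤ N ∧ D * d * Real.log N ≤ N := by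
  refine ⟨36 * D ^ 2 + 10 * N₀ + 10, by positivity, fun d N hd h => ?_⟩
  set C := 36 * D ^ 2 + 10 * N₀ + 10
  have hd' : (2 : ℝ) ≤ d := by exact_mod_cast hd
  have hd0 : (0 : ℝ) < d := by linarith
  have hL : (0.69 : ℝ) ≤ Real.log d := by
    have := Real.log_le_log (by norm_num) hd'
    linarith [Real.log_two_gt_d9]
  have hL2 : (0.4 : ℝ) ≤ Real.log d ^ 2 := by nlinarith
  set r : ℝ := N / d with hr
  have hNr : (N : ℝ) = d * r := by
    rw [hr]
    field_simp
  have hrC : C * Real.log d ^ 2 ≤ r := by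
    rw [hr, le_div_iff₀ hd0]
    linarith
  have hC : 0 ≤ C := by positivity
  have hr1 : C * 0.4 ≤ r := (mul_le_mul_of_nonneg_left hL2 hC).trans hrC
  have hCdef : C = 36 * D ^ 2 + 10 * N₀ + 10 := rfl
  have hr4 : 4 ≤ r := by nlinarith [sq_nonneg D]
  have hrN₀ : N₀ ≤ r := by nlinarith [sq_nonneg D]
  have hrD : (3 * D) ^ 2 ≤ r := by nlinarith [sq_nonneg D]
  have hNr1 : r ≤ N := by
    rw [hNr]
    nlinarith
  have hNd : (d : ℝ) ≤ N := by
    rw [hNr]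
    nlinarith
  refine ⟨hrN₀.trans hNr1, ?_, by exact_mod_cast hNd, ?_⟩
  · have : (3 : ℝ) ≤ N := by linarith
    exact_mod_cast this
  have hr0 : 0 < r := by linarith
  have hsr : Real.sqrt r * Real.sqrt r = r := Real.mul_self_sqrt hr0.le
  have hlogd : Real.log d ≤ Real.sqrt r := by
    refine Real.le_sqrt_of_sq_le ?_
    have : 1 ≤ C := by nlinarith [sq_nonneg D]
    nlinarith [sq_nonneg (Real.log d)]
  have hlogr : Real.log r ≤ 2 * Real.sqrt r := by
    have h1 := Real.log_le_sub_one_of_pos (Real.sqrt_pos.2 hr0)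
    rw [Real.log_sqrt hr0.le] at h1
    linarith
  have hDs : 3 * D ≤ Real.sqrt r := Real.le_sqrt_of_sq_le hrD
  have hlogN : Real.log N ≤ 3 * Real.sqrt r := by
    rw [hNr, Real.log_mul hd0.ne' hr0.ne']
    linarith
  have hlogN0 : 0 ≤ Real.log N := Real.log_natCast_nonneg N
  have hfin : D * Real.log N ≤ r := by
    rcases le_total D 0 with hD | hD
    · nlinarith
    · nlinarith [mul_le_mul_of_nonneg_left hlogN hD, Real.sqrt_nonneg r]
  rw [hNr] at hfin ⊢
  nlinarith

theorem mul_exp_neg_six_log_le {d N : ℕ} (hd : 0 < d) (hN : 3 ≤ N) (hdN : d ≤ N) :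
    N * (2 * Real.exp (-(6 * Real.log N))) ≤ 1 / 2 * (1 / (d : ℝ) ^ 3) := by
  have hN' : (3 : ℝ) ≤ N := by exact_mod_cast hN
  have hd' : (0 : ℝ) < d := by exact_mod_cast hd
  have hdN' : (d : ℝ) ≤ N := by exact_mod_cast hdN
  have he : Real.exp (-(6 * Real.log N)) = 1 / (N : ℝ) ^ 6 := by
    rw [Real.exp_neg, mul_comm, Real.exp_mul, Real.exp_log (by linarith), one_div]
    norm_cast
  rw [he]
  have h3 : (d : ℝ) ^ 3 ≤ N ^ 3 := pow_le_pow_left₀ hd'.le hdN' 3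
  have e1 : N * (2 * (1 / (N : ℝ) ^ 6)) = 2 / N ^ 5 := by
    field_simp
  have e2 : 1 / 2 * (1 / (d : ℝ) ^ 3) = 1 / (2 * d ^ 3) := by
    field_simp
  rw [e1, e2, div_le_div_iff₀ (by positivity) (by positivity)]
  have : (N : ℝ) ^ 5 = N ^ 3 * N ^ 2 := by ring
  have h9 : (9 : ℝ) ≤ N ^ 2 := by nlinarith
  have := mul_le_mul_of_nonneg_left h9 (by positivity : (0 : ℝ) ≤ (N : ℝ) ^ 3)
  nlinarith [pow_pos hd' 3]

/-- The exponent `10d` splits as `4d + 3d + 3d`: for `25^d ≤ e^(4d)`, for `d³ ≤ e^(3d)`, and for the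
remaining factor `4`. -/
theorem pow_mul_exp_neg_le {d : ℕ} (hd : 0 < d) {y : ℝ} (hy : 10 * (d : ℝ) ≤ y) :
    25 ^ d * (2 * Real.exp (-y)) ≤ 1 / 2 * (1 / (d : ℝ) ^ 3) := by
  have hd' : (1 : ℝ) ≤ d := by exact_mod_cast hd
  have he : (25 : ℝ) ≤ Real.exp 4 := by
    have h1 := Real.exp_one_gt_d9
    have h2 : Real.exp 4 = Real.exp 1 ^ 4 := by
      rw [← Real.exp_nat_mul]
      norm_num
    rw [h2]
    have h3 : (2.7 : ℝ) ^ 4 ≤ Real.exp 1 ^ 4 := pow_le_pow_left₀ (by norm_num) (by linarith) 4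
    norm_num at h3 ⊢
    linarith
  have h25 : (25 : ℝ) ^ d ≤ Real.exp (4 * d) := by
    rw [mul_comm, Real.exp_nat_mul]
    exact pow_le_pow_left₀ (by norm_num) he d
  have hexp : Real.exp (-y) ≤ Real.exp (-(10 * d)) := Real.exp_le_exp.2 (by linarith)
  have hde : (d : ℝ) ≤ Real.exp d := by linarith [Real.add_one_le_exp (d : ℝ)]
  have h3 : (d : ℝ) ^ 3 ≤ Real.exp (3 * d) := by
    have := pow_le_pow_left₀ (by linarith) hde 3
    rwa [← Real.exp_nat_mul] at this
  have h4 : 4 ≤ Real.exp (3 * d) := by linarith [Real.add_one_le_exp (3 * (d : ℝ))]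
  have e2 : 1 / 2 * (1 / (d : ℝ) ^ 3) = 1 / (2 * d ^ 3) := by
    field_simp
  rw [e2, le_div_iff₀ (by positivity)]
  calc 25 ^ d * (2 * Real.exp (-y)) * (2 * (d : ℝ) ^ 3)
      ≤ Real.exp (4 * d) * (2 * Real.exp (-(10 * d))) * (2 * Real.exp (3 * d)) := by gcongr
    _ = 4 * Real.exp (-(3 * d)) := by
        have : Real.exp (4 * d) * (2 * Real.exp (-(10 * d))) * (2 * Real.exp (3 * d))
          = 4 * (Real.exp (4 * d) * Real.exp (-(10 * d)) * Real.exp (3 * d)) := by ring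
        rw [this, ← Real.exp_add, ← Real.exp_add]
        ring_nf
    _ ≤ 1 := by
        rw [Real.exp_neg, ← div_eq_mul_inv, div_le_one (Real.exp_pos _)]
        exact h4

end Numerics

/-! ### Choice of constants and the theorem. -/

section Assembly

variable {𝕜 : Type*} [RCLike 𝕜] {d : ℕ} {Ω : Type*} [MeasurableSpace Ω] {μ : Measure Ω}
  [IsProbabilityMeasure μ]

theorem hasExpMoment_measurement {a : Ω → EuclideanSpace 𝕜 (Fin d)} (ha : Measurable a) {K : ℝ≥0}
    (h : vecPsi2Norm a μ ≤ K) (v : EuclideanSpace 𝕜 (Fin d)) (hv : ‖v‖ = 1) :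
    HasExpMoment (1 / (12 * ((K : ℝ) + 1) ^ 2)) (fun ω => measurement (a ω) v) μ := by
  refine hasExpMoment_of_psi2Norm_le (X := fun ω => inner 𝕜 (a ω) v) (by fun_prop) ?_
  exact (le_iSup (fun v : Metric.sphere (0 : EuclideanSpace 𝕜 (Fin d)) 1 =>
    psi2Norm (fun ω => inner 𝕜 (a ω) (v : EuclideanSpace 𝕜 (Fin d))) μ)
    ⟨v, by simpa using hv⟩).trans h

theorem nontrivial_euclideanSpace (hd : 2 ≤ d) : Nontrivial (EuclideanSpace 𝕜 (Fin d)) :=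
  ⟨EuclideanSpace.single ⟨0, by omega⟩ 1, 0, fun h => by
    have := congrArg norm h
    simp at this⟩

theorem one_sub_sub_two_mul_exp_nonpos (d : ℕ) (c : ℝ) :
    1 - 1 / (d : ℝ) ^ 3 - 2 * Real.exp (-c * (0 : ℕ)) ≤ 0 := by
  have : 0 ≤ 1 / (d : ℝ) ^ 3 := by positivity
  simp only [Nat.cast_zero, mul_zero, Real.exp_zero]
  linarith

end Assembly

end PhaseRetrieval

open PhaseRetrieval in
theorem theorem2p2 {𝕜 : Type*} [RCLike 𝕜] (K : ℝ≥0) (τ₁ τ₂ τ₃ τ₄ : ℝ) (ε : ℝ) (hε : 0 < ε) :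
    ∃ c C : ℝ, 0 < c ∧ 0 < C ∧
      ∀ (d N : ℕ) (Ω : Type*) [MeasurableSpace Ω] (μ : Measure Ω) [IsProbabilityMeasure μ]
        (a : Fin N → Ω → EuclideanSpace 𝕜 (Fin d)),
        (∀ j, Measurable (a j)) →
        iIndepFun a μ →
        (∀ i j, IdentDistrib (a i) (a j) μ μ) →
        (∀ j, PhaseRetrieval.vecPsi2Norm (a j) μ ≤ (K : ℝ≥0∞)) →
        (∀ j, PhaseRetrieval.ConditionI (a j) μ) →
        (∀ j, PhaseRetrieval.ConditionII (a j) μ τ₁ τ₂ τ₃ τ₄) →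
        C * d * (Real.log d) ^ 2 ≤ N →
        ∀ x : EuclideanSpace 𝕜 (Fin d),
          ∃ E : Set Ω, MeasurableSet E ∧
            1 - 1 / (d : ℝ) ^ 3 - 2 * Real.exp (-c * N) ≤ μ.real E ∧
            ∀ ω ∈ E, ∀ z₀ : EuclideanSpace 𝕜 (Fin d),
              PhaseRetrieval.IsSpectralInit τ₁ τ₂ τ₃ τ₄ (fun j => a j ω) x z₀ →
              PhaseRetrieval.phaseDist z₀ x ≤ ε * ‖x‖ := by
  -- The constants are chosen before the distribution. For inadmissible `τ` any will do: no sample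
  -- with `N > 0` satisfies the hypotheses, and for `N = 0` the probability bound is nonpositive.
  by_cases hadm : τ₁ ≠ 0 ∧ 0 < τ₃ ∧ τ₃ + τ₄ ≠ 0
  swap
  · refine ⟨1, 1, one_pos, one_pos, ?_⟩
    intro d N Ω _ μ _ a ha _ _ hK hI hII _ x
    rcases Nat.eq_zero_or_pos N with rfl | hN
    · exact ⟨∅, MeasurableSet.empty, by simpa using one_sub_sub_two_mul_exp_nonpos d 1,
        fun ω hω => hω.elim⟩
    · have := nontrivial_euclideanSpace (𝕜 := 𝕜) (hI ⟨0, hN⟩).two_le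
      exact absurd ((hI ⟨0, hN⟩).parameters (hII _) (by positivity) (ha _)
        (hasExpMoment_measurement (ha _) (hK _))) hadm
  obtain ⟨hτ₁, hτ₃, hτ⟩ := hadm
  have hτ₁' : 0 < |τ₁| := abs_pos.2 hτ₁
  set q : ℝ := 1 + |τ₄ / (τ₃ + τ₄)| * (1 + |τ₂|) with hq
  have hq0 : 0 < q := by positivity
  -- The form of `Y` is controlled up to `64δ`; the bounds are what the perturbation step needs with
  -- `η = ε/2`.
  obtain ⟨δ, hδ, hδ1, hδε, hδq⟩ : ∃ δ : ℝ, 0 < δ ∧ 64 * δ ≤ 1 ∧ 64 * δ ≤ ε / 2 ∧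
      64 * δ ≤ τ₃ * (ε / 2) ^ 2 / (4 * q) := by
    refine ⟨min (min 1 (ε / 2)) (τ₃ * (ε / 2) ^ 2 / (4 * q)) / 64, by positivity, ?_, ?_, ?_⟩ <;>
      rw [mul_div_cancel₀ _ (by norm_num)]
    · exact (min_le_left _ _).trans (min_le_left _ _)
    · exact (min_le_left _ _).trans (min_le_right _ _)
    · exact min_le_right _ _
  set S : ℝ := 1 / (12 * ((K : ℝ) + 1) ^ 2) with hSdef
  have hS : 0 < S := by positivity
  have hS1 : S ≤ 1 := by
    rw [hSdef, div_le_one (by positivity)]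
    nlinarith [K.coe_nonneg]
  obtain ⟨θ, hθ, hθS, hθδ⟩ : ∃ θ : ℝ, 0 < θ ∧ θ ≤ S / 2 ∧ 2 * θ * (4096 / S ^ 4) ≤ δ := by
    refine ⟨min (S / 2) (δ / (2 * (4096 / S ^ 4))), by positivity, min_le_left _ _, ?_⟩
    have := min_le_right (S / 2) (δ / (2 * (4096 / S ^ 4)))
    rw [le_div_iff₀ (by positivity)] at this
    linarith
  obtain ⟨l, hl, hlS, hlδ⟩ : ∃ l : ℝ, 0 < l ∧ l ≤ S / 2 ∧ 2 * l * (32 / S ^ 2) ≤ |τ₁| * δ := by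
    refine ⟨min (S / 2) (|τ₁| * δ / (2 * (32 / S ^ 2))), by positivity, min_le_left _ _, ?_⟩
    have := min_le_right (S / 2) (|τ₁| * δ / (2 * (32 / S ^ 2)))
    rw [le_div_iff₀ (by positivity)] at this
    linarith
  -- The first threshold makes the truncation bias at most `δ`. The second gives `N/log N ≥
  -- 120d/(θδS)`, so that the Chernoff exponent `(θδS/12)(N/log N)` is at least `10d`.
  obtain ⟨C, hC, hlarge⟩ := exists_const_forall_ge_mul_log (64 / S ^ 2 / δ) (120 / (θ * δ * S))
    (by positivity)
  refine ⟨l * (|τ₁| * δ) / 2, C, by positivity, hC, ?_⟩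
  intro d N Ω _ μ _ a ha hind _ hK hI hII hCN x
  rcases Nat.eq_zero_or_pos N with rfl | hN
  · exact ⟨∅, MeasurableSet.empty, by simpa using one_sub_sub_two_mul_exp_nonpos d 1,
      fun ω hω => hω.elim⟩
  have hd := (hI ⟨0, hN⟩).two_le
  have := nontrivial_euclideanSpace (𝕜 := 𝕜) hd
  obtain ⟨hN₀, hN3, hdN, hlog⟩ := hlarge d N hd hCN
  have hN3' : (3 : ℝ) ≤ N := by exact_mod_cast hN3
  have hN' : (0 : ℝ) < N := by linarith
  have hlogN : 1 ≤ Real.log N := by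
    rw [Real.le_log_iff_exp_le hN']
    linarith [Real.exp_one_lt_three]
  -- With this level `exp(-ST) = N⁻⁶`, which survives the union over `N` samples, and the bias is of
  -- order `N^(-3/2)`.
  set T : ℝ := 6 / S * Real.log N with hTdef
  have hST : S * T = 6 * Real.log N := by
    rw [hTdef]
    field_simp
  have hT1 : 1 ≤ T := by
    have h6 : 1 ≤ 6 / S := by
      rw [one_le_div hS]
      linarith
    nlinarith
  have hT0 : 0 < T := by linarith
  have hTδ : 64 / S ^ 2 * Real.exp (-(S / 4 * T)) ≤ δ := by
    have h1 : Real.exp (-(S / 4 * T)) ≤ (N : ℝ)⁻¹ := by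
      rw [← Real.exp_log (inv_pos.2 hN'), Real.log_inv]
      refine Real.exp_le_exp.2 ?_
      linarith
    rw [div_le_iff₀ hδ] at hN₀
    calc 64 / S ^ 2 * Real.exp (-(S / 4 * T)) ≤ 64 / S ^ 2 * (N : ℝ)⁻¹ := by gcongr
      _ ≤ δ := by
        rw [← div_eq_mul_inv, div_le_iff₀ hN']
        linarith
  have hθT : θ / T ≤ S / (2 * T) := by
    rw [div_le_div_iff₀ hT0 (by positivity)]
    nlinarith
  have hθTδ : 2 * (θ / T) * (4096 / S ^ 4) ≤ δ := by
    refine le_trans ?_ hθδ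
    gcongr
    exact div_le_self hθ.le hT1
  obtain ⟨G, hGm, hGp, hG⟩ := exists_concentration_event hN hS ha hind
    (fun j => hasExpMoment_measurement (ha j) (hK j)) hII hτ₁ hT0 hTδ (by positivity) hθT hθTδ
    hl.le hlS hlδ x
  refine ⟨G, hGm, le_trans ?_ hGp, fun ω hω z₀ hz => ?_⟩
  · have h1 := mul_exp_neg_six_log_le (by omega : 0 < d) hN3 hdN
    have hy : 10 * (d : ℝ) ≤ θ / T * δ / 2 * N := by
      have e : θ / T * δ / 2 * N = θ * δ * S / 12 * (N / Real.log N) := by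
        rw [hTdef]
        field_simp
        norm_num
      have h2 : 120 / (θ * δ * S) * d ≤ N / Real.log N := by
        rwa [le_div_iff₀ (by linarith)]
      rw [e]
      refine le_trans (le_of_eq ?_) (mul_le_mul_of_nonneg_left h2 (by positivity))
      field_simp
      norm_num
    have h2 := pow_mul_exp_neg_le (by omega : 0 < d) hy
    rw [hST]
    have e3 : -(l * (|τ₁| * δ) / 2) * (N : ℝ) = -(l * (|τ₁| * δ) / 2 * N) := by ring
    rw [e3]
    linarith
  · obtain ⟨hY, hρ⟩ := hG ω hω
    have h64 : δ * ‖x‖ ^ 2 ≤ 64 * δ * ‖x‖ ^ 2 := by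
      gcongr
      linarith
    refine phaseDist_le_of_isSpectralInit hτ hτ₃ hδ1 (by positivity : 0 ≤ ε / 2) ?_ (by linarith)
      hY (hρ.trans h64) hz
    rw [le_div_iff₀ (by positivity)] at hδq
    linarith
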